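/- Let $N\ge 0$, let $\Bbbk$ be a commutative Hausdorff topological $\mathbb Q$-algebra (for instance $\mathbb C$, or $\mathbb C[[\hbar]]$ with the coefficientwise topology), let $a_1,\dots,a_N\in\Bbbk$ be invertible, $A=\mathrm{diag}(a_1,\dots,a_N)$, and let $E_{jj}$ be the diagonal matrix units. The times are $t_n^j$, $1\le j\le N$, $n=1,3,5,\dots$, and $\partial=\sum_j a_j^{-1}\partial_{t_1^j}$. We consider $N\times N$ matrix pseudo-differential operators in $\partial$ whose coefficients are formal power series in all the times over $\Bbbk$; $P_-$ denotes the part of $P$ with strictly negative powers of $\partial$, and $(\sum_l p_l\partial^l)^*=\sum_l(-1)^l\partial^l p_l^T$. A dressing operator of the $N$-component BKP hierarchy is an operator $\Phi=1+w_1\partial^{-1}+w_2\partial^{-2}+\cdots$ with $\Phi^*=\partial\Phi^{-1}\partial^{-1}$ which satisfies, with $L=\Phi A\partial\Phi^{-1}$ and $R_j=\Phi E_{jj}\Phi^{-1}$, the Sato equations $$\frac{\partial\Phi}{\partial t_n^j}=-(L^nR_j)_-\,\Phi\qquad(1\le j\le N,\ n \text{ odd}).$$ Put $$\Gamma=\sum_{n\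 \mathrm{odd}}\sum_{j=1}^N n\,t_n^jA^{n-1}E_{jj}\partial^{n-1},\quad M=\Phi\Gamma\Phi^{-1},\quad B_{prs}=M^pL^rR_s-(-1)^rR_sL^{r-1}M^pL .$$ Fix $\log q\in\Bbbk$. For integers $l,k\ge0$ and $1\le s\le N$ let $$D_{lks}=e^{lM}q^{kL}R_s-L^{-1}R_sq^{-kL}e^{lM}L=\sum_{p,r\ge0}\frac{l^p(k\log q)^r}{p!\,r!}B_{prs},$$ and let $(D_{lks})_-$ be the coefficientwise sum of the series of negative parts. The additional flow $\partial_{t^{*s}_{l,k}}$ is given by $\partial_{t^{*s}_{l,k}}\Phi=-(D_{lks})_-\Phi$; it acts on expressions in $\Phi$ by first variation, i.e. $\partial_{t^{*s}_{l,k}}F(\Phi)$ is the coefficient of $\varepsilon$ in $F(\Phi-\varepsilon (D_{lks})_-\Phi)$, $\varepsilon^2=0$. **Theorem.** (1) The additional flows are symmetries of the $N$-component BKP hierarchy, i.e. they commute with all flows $\partial_{t_n^j}$: for every dressing operator $\Phi$, all $l,k\ge0$, $1\le s,j\le N$ and all odd $n\ge 1$, if the series defining $(D_{lks})_-$ converges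 coefficientwise, then $$[\partial_{t^{*s}_{l,k}},\partial_{t_n^j}]\Phi=\partial_{t^{*s}_{l,k}}\bigl(-(L^nR_j)_-\Phi\bigr)-\partial_{t_n^j}\bigl(-(D_{lks})_-\Phi\bigr)=0 .$$ (2) If $\log q$ is a formal parameter, i.e. $\Bbbk=\mathbb C[[\hbar]]$ and $\log q=\hbar$, the series defining $(D_{lks})_-$ converges coefficientwise for every dressing operator $\Phi$ and all $l,k,s$. -/

import Mathlib

open scoped PowerSeries.WithPiTopology

noncomputable section

/-! ### Scalar formal pseudo-differential operators over a differential ring -/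

namespace BKP

/-- Coefficient families `(c_l)_{l ∈ ℤ}` that vanish for all large `l`. -/
def boundedAbove (F : Type*) [CommRing F] : AddSubgroup (ℤ → F) where
  carrier := {c | ∃ n : ℤ, ∀ l, n < l → c l = 0}
  zero_mem' := ⟨0, fun _ _ => rfl⟩
  add_mem' := by
    rintro c e ⟨n, hn⟩ ⟨m, hm⟩
    refine ⟨max n m, fun l hl => ?_⟩
    simp [hn l (lt_of_le_of_lt (le_max_left _ _) hl), hm l (lt_of_le_of_lt (le_max_right _ _) hl)]
  neg_mem' := by
    rintro c ⟨n, hn⟩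
    exact ⟨n, fun l hl => by simp [hn l hl]⟩

/-- Formal pseudo-differential operators `P = ∑_{l ≤ n} c_l ∂^l` with coefficients in the
differential ring `(F, d)`, written with the coefficients on the left of the powers of `∂`. -/
def PsiDO {k F : Type*} [CommRing k] [CommRing F] [Algebra k F] (_d : Derivation k F F) : Type _ :=
  boundedAbove F

namespace PsiDO

variable {k F : Type*} [CommRing k] [CommRing F] [Algebra k F] {d : Derivation k F F}

instance : AddCommGroup (PsiDO d) := inferInstanceAs (AddCommGroup (boundedAbove F))

/-- The coefficient of `∂^l`. -/
def coeff (P : PsiDO d) (l : ℤ) : F := P.1 l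

theorem bounded (P : PsiDO d) : ∃ n : ℤ, ∀ l, n < l → P.coeff l = 0 := P.2

@[ext] theorem ext {P Q : PsiDO d} (h : ∀ l, P.coeff l = Q.coeff l) : P = Q :=
  Subtype.ext (funext h)

@[simp] theorem coeff_zero (l : ℤ) : (0 : PsiDO d).coeff l = 0 := rfl
@[simp] theorem coeff_add (P Q : PsiDO d) (l : ℤ) : (P + Q).coeff l = P.coeff l + Q.coeff l := rfl
@[simp] theorem coeff_neg (P : PsiDO d) (l : ℤ) : (-P).coeff l = -P.coeff l := rfl
@[simp] theorem coeff_sub (P Q : PsiDO d) (l : ℤ) : (P - Q).coeff l = P.coeff l - Q.coeff l := rfl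

/-- The operator `f ∂^l`. -/
def mono (f : F) (l : ℤ) : PsiDO d :=
  ⟨fun m => if m = l then f else 0, l, fun m hm => if_neg (by omega)⟩

theorem coeff_mono (f : F) (l m : ℤ) : (mono f l : PsiDO d).coeff m = if m = l then f else 0 := rfl

/-- The coefficient of `∂^m` in the product, from
`(b ∂^l) (c ∂^n) = ∑_r binom(l, r) b d^r(c) ∂^(l + n - r)`. Only finitely many terms are nonzero. -/
def mulCoeff (P Q : PsiDO d) (m : ℤ) : F :=
  ∑ᶠ p : ℤ × ℕ, Ring.choose p.1 p.2 • (P.coeff p.1 * d^[p.2] (Q.coeff (m - p.1 + p.2)))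

/-- Coefficient of `∂^(a + b - n)` in a product of operators of orders at most `a` and `b`. -/
def star (a b : ℤ) (P Q : PsiDO d) (n : ℕ) : F :=
  ∑ x ∈ Finset.HasAntidiagonal.antidiagonal n, ∑ y ∈ Finset.HasAntidiagonal.antidiagonal x.1,
    Ring.choose (a - y.1) y.2 • (P.coeff (a - y.1) * d^[y.2] (Q.coeff (b - x.2)))

theorem iter_zero (r : ℕ) : d^[r] (0 : F) = 0 := by
  induction r with
  | zero => rfl
  | succ r ih => rw [Function.iterate_succ_apply, map_zero, ih]

theorem iter_add (r : ℕ) (f g : F) : d^[r] (f + g) = d^[r] f + d^[r] g := by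
  induction r generalizing f g with
  | zero => rfl
  | succ r ih => simp only [Function.iterate_succ_apply, map_add, ih]

theorem iter_smul (r : ℕ) (z : ℤ) (f : F) : d^[r] (z • f) = z • d^[r] f := by
  induction r generalizing f with
  | zero => rfl
  | succ r ih => simp only [Function.iterate_succ_apply, map_zsmul, ih]

theorem iter_sum {ι : Type*} (s : Finset ι) (r : ℕ) (f : ι → F) :
    d^[r] (∑ i ∈ s, f i) = ∑ i ∈ s, d^[r] (f i) := by
  induction r generalizing f with
  | zero => rfl
  | succ r ih => simp only [Function.iterate_succ_apply, map_sum, ih]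

theorem iter_of_const {f : F} (hf : d f = 0) {r : ℕ} (hr : r ≠ 0) : d^[r] f = 0 := by
  obtain ⟨r, rfl⟩ := Nat.exists_eq_succ_of_ne_zero hr
  rw [Function.iterate_succ_apply, hf, iter_zero]

theorem iter_mul (r : ℕ) (f g : F) :
    d^[r] (f * g) = ∑ x ∈ Finset.HasAntidiagonal.antidiagonal r, r.choose x.1 • (d^[x.1] f * d^[x.2] g) := by
  induction r with
  | zero => simp
  | succ r ih =>
    rw [Function.iterate_succ_apply', ih, map_sum,
      Finset.sum_antidiagonal_choose_succ_nsmul (fun i j => d^[i] f * d^[j] g) r,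
      ← Finset.sum_add_distrib]
    refine Finset.sum_congr rfl fun x hx => ?_
    rw [Finset.HasAntidiagonal.mem_antidiagonal] at hx
    have : r.choose x.2 = r.choose x.1 := Nat.choose_symm_of_eq_add (by omega)
    rw [this, ← smul_add, map_nsmul, Derivation.leibniz, Function.iterate_succ_apply',
      Function.iterate_succ_apply', smul_eq_mul, smul_eq_mul]
    ring_nf

theorem mulCoeff_eq_star {a b : ℤ} {P Q : PsiDO d} (hP : ∀ l, a < l → P.coeff l = 0)
    (hQ : ∀ l, b < l → Q.coeff l = 0) (n : ℕ) : mulCoeff P Q (a + b - n) = star a b P Q n := by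
  unfold mulCoeff star
  rw [Finset.sum_sigma']
  let e : (Σ _ : ℕ × ℕ, ℕ × ℕ) → ℤ × ℕ := fun z => (a - z.2.1, z.2.2)
  have hinj : Set.InjOn e ((Finset.HasAntidiagonal.antidiagonal n).sigma fun x => Finset.HasAntidiagonal.antidiagonal x.1) := by
    rintro ⟨⟨x1, x2⟩, ⟨y1, y2⟩⟩ h ⟨⟨x1', x2'⟩, ⟨y1', y2'⟩⟩ h' he
    simp only [Finset.coe_sigma, Set.mem_sigma_iff, Finset.mem_coe, Finset.HasAntidiagonal.mem_antidiagonal] at h h'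
    simp only [e, Prod.mk.injEq] at he
    have h1 : y1 = y1' := by omega
    have h2 : y2 = y2' := he.2
    have h3 : x1 = x1' := by omega
    have h4 : x2 = x2' := by omega
    subst h1 h2 h3 h4
    rfl
  rw [finsum_eq_sum_of_support_subset (s := ((Finset.HasAntidiagonal.antidiagonal n).sigma
    fun x => Finset.HasAntidiagonal.antidiagonal x.1).image e), Finset.sum_image hinj]
  · refine Finset.sum_congr rfl ?_
    rintro ⟨⟨x1, x2⟩, ⟨y1, y2⟩⟩ h
    simp only [Finset.mem_sigma, Finset.HasAntidiagonal.mem_antidiagonal] at h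
    have : a + b - (n : ℤ) - (a - y1) + y2 = b - x2 := by omega
    simp only [e, this]
  · rintro ⟨l, r⟩ h
    rw [Function.mem_support] at h
    have h1 : l ≤ a := by
      by_contra hl
      exact h (by simp [hP l (by omega)])
    have h2 : a + b - (n : ℤ) - l + r ≤ b := by
      by_contra hl
      exact h (by simp only [hQ _ (not_le.mp hl), iter_zero, mul_zero, smul_zero])
    simp only [Finset.coe_image, Set.mem_image, Finset.mem_coe, Finset.mem_sigma,
      Finset.HasAntidiagonal.mem_antidiagonal]
    refine ⟨⟨((a - l).toNat + r, n - ((a - l).toNat + r)), ((a - l).toNat, r)⟩,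
      ⟨by simp only; omega, rfl⟩, ?_⟩
    simp only [e, Prod.mk.injEq, and_true]
    omega

theorem mulCoeff_eq_zero {a b : ℤ} {P Q : PsiDO d} (hP : ∀ l, a < l → P.coeff l = 0)
    (hQ : ∀ l, b < l → Q.coeff l = 0) (m : ℤ) (hm : a + b < m) : mulCoeff P Q m = 0 := by
  unfold mulCoeff
  rw [← finsum_zero (α := ℤ × ℕ)]
  refine finsum_congr fun p => ?_
  by_cases h : a < p.1
  · simp [hP _ h]
  · rw [hQ _ (by omega), iter_zero, mul_zero, smul_zero]

instance : Mul (PsiDO d) where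
  mul P Q := ⟨mulCoeff P Q, by
    obtain ⟨a, ha⟩ := P.bounded
    obtain ⟨b, hb⟩ := Q.bounded
    exact ⟨a + b, mulCoeff_eq_zero ha hb⟩⟩

instance : One (PsiDO d) := ⟨mono 1 0⟩

theorem coeff_mul (P Q : PsiDO d) (m : ℤ) : (P * Q).coeff m = mulCoeff P Q m := rfl

theorem coeff_one (m : ℤ) : (1 : PsiDO d).coeff m = if m = 0 then 1 else 0 := rfl

theorem exists_common_bound (P Q : PsiDO d) :
    ∃ n : ℤ, (∀ l, n < l → P.coeff l = 0) ∧ (∀ l, n < l → Q.coeff l = 0) := by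
  obtain ⟨a, ha⟩ := P.bounded
  obtain ⟨b, hb⟩ := Q.bounded
  exact ⟨max a b, fun l hl => ha l (lt_of_le_of_lt (le_max_left _ _) hl),
    fun l hl => hb l (lt_of_le_of_lt (le_max_right _ _) hl)⟩

theorem ext_of_bound {P Q : PsiDO d} (a : ℤ) (hP : ∀ l, a < l → P.coeff l = 0)
    (hQ : ∀ l, a < l → Q.coeff l = 0) (h : ∀ n : ℕ, P.coeff (a - n) = Q.coeff (a - n)) :
    P = Q := by
  ext l
  by_cases hl : a < l
  · rw [hP l hl, hQ l hl]
  · have := h (a - l).toNat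
    rwa [show a - ((a - l).toNat : ℤ) = l by omega] at this

theorem left_distrib' (P Q R : PsiDO d) : P * (Q + R) = P * Q + P * R := by
  obtain ⟨a, ha⟩ := P.bounded
  obtain ⟨b, hb, hc⟩ := exists_common_bound Q R
  have hbc : ∀ l, b < l → (Q + R).coeff l = 0 := fun l hl => by simp [hb l hl, hc l hl]
  refine ext_of_bound (a + b) (mulCoeff_eq_zero ha hbc) (fun l hl => ?_) fun n => ?_
  · rw [coeff_add, coeff_mul, coeff_mul, mulCoeff_eq_zero ha hb l hl, mulCoeff_eq_zero ha hc l hl,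
      add_zero]
  · rw [coeff_add, coeff_mul, coeff_mul, coeff_mul, mulCoeff_eq_star ha hbc,
      mulCoeff_eq_star ha hb, mulCoeff_eq_star ha hc]
    simp only [star, coeff_add, iter_add, mul_add, smul_add, Finset.sum_add_distrib]

theorem right_distrib' (P Q R : PsiDO d) : (P + Q) * R = P * R + Q * R := by
  obtain ⟨a, ha, hc⟩ := exists_common_bound P Q
  obtain ⟨b, hb⟩ := R.bounded
  have hac : ∀ l, a < l → (P + Q).coeff l = 0 := fun l hl => by simp [ha l hl, hc l hl]
  refine ext_of_bound (a + b) (mulCoeff_eq_zero hac hb) (fun l hl => ?_) fun n => ?_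
  · rw [coeff_add, coeff_mul, coeff_mul, mulCoeff_eq_zero ha hb l hl, mulCoeff_eq_zero hc hb l hl,
      add_zero]
  · rw [coeff_add, coeff_mul, coeff_mul, coeff_mul, mulCoeff_eq_star hac hb,
      mulCoeff_eq_star ha hb, mulCoeff_eq_star hc hb]
    simp only [star, coeff_add, add_mul, smul_add, Finset.sum_add_distrib]

theorem mulCoeff_mono_left (f : F) (l : ℤ) (Q : PsiDO d) (m : ℤ) :
    mulCoeff (mono f l) Q m
      = ∑ᶠ r : ℕ, Ring.choose l r • (f * d^[r] (Q.coeff (m - l + r))) := by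
  unfold mulCoeff
  rw [← finsum_mem_univ, ← finsum_mem_range (f := fun p : ℤ × ℕ =>
    Ring.choose p.1 p.2 • (f * d^[p.2] (Q.coeff (m - p.1 + p.2)))) (g := fun r : ℕ => (l, r))
    (fun a b h => by simpa using h)]
  rw [← finsum_mem_inter_support, ← finsum_mem_inter_support (s := Set.range _)]
  refine finsum_mem_congr ?_ ?_
  · ext ⟨i, r⟩
    by_cases hi : i = l
    · subst hi
      simp [coeff_mono]
    · simp [coeff_mono, hi, Ne.symm hi]
  · rintro ⟨i, r⟩ ⟨⟨r', hr'⟩, -⟩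
    simp only [Prod.mk.injEq] at hr'
    simp [coeff_mono, hr'.1]

theorem one_mul' (P : PsiDO d) : 1 * P = P := by
  ext m
  change mulCoeff (mono 1 0) P m = _
  rw [mulCoeff_mono_left, finsum_eq_single _ 0]
  · simp
  · intro r hr
    obtain ⟨r, rfl⟩ := Nat.exists_eq_succ_of_ne_zero hr
    rw [Nat.succ_eq_add_one, Ring.choose_zero_succ, zero_smul]

/-- Right multiplication by `f ∂^l` when `f` is a constant. -/
theorem coeff_mul_mono (P : PsiDO d) {f : F} (hf : d f = 0) (l m : ℤ) :
    (P * mono f l).coeff m = P.coeff (m - l) * f := by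
  rw [coeff_mul]
  unfold mulCoeff
  rw [finsum_eq_single _ (m - l, 0)]
  · simp [coeff_mono]
  · rintro ⟨i, r⟩ h
    by_cases hr : r = 0
    · subst hr
      have hi : i ≠ m - l := fun hi => h (by simp [hi])
      have : m - i + ((0 : ℕ) : ℤ) ≠ l := by simp only [Nat.cast_zero]; omega
      simp only [coeff_mono, if_neg this, iter_zero, mul_zero, smul_zero]
    · have : d^[r] ((mono f l : PsiDO d).coeff (m - i + r)) = 0 := by
        rw [coeff_mono]
        split_ifs
        · exact iter_of_const hf hr
        · exact iter_zero r
      simp only [this, mul_zero, smul_zero]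

theorem mono_mul_mono (f : F) {g : F} (hg : d g = 0) (l m : ℤ) :
    (mono f l * mono g m : PsiDO d) = mono (f * g) (l + m) := by
  ext i
  rw [coeff_mul_mono _ hg, coeff_mono, coeff_mono]
  by_cases h : i = l + m
  · subst h; simp
  · rw [if_neg h, if_neg (by omega), zero_mul]

theorem mul_one' (P : PsiDO d) : P * 1 = P := by
  ext m
  change (P * mono 1 0).coeff m = _
  rw [coeff_mul_mono P d.map_one_eq_zero]
  simp

theorem choose_identity (a b : ℤ) (r s : ℕ) :
    Ring.choose a r * Ring.choose (a - r + b) s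
      = ∑ x ∈ Finset.HasAntidiagonal.antidiagonal s,
        ((r + x.1).choose r : ℤ) * (Ring.choose a (r + x.1) * Ring.choose b x.2) := by
  rw [Ring.add_choose_eq s (Commute.all (a - (r : ℤ)) b), Finset.mul_sum]
  refine Finset.sum_congr rfl fun x _ => ?_
  have := Ring.choose_smul_choose a (Nat.le_add_right r x.1)
  rw [Nat.add_sub_cancel_left, nsmul_eq_mul] at this
  rw [← mul_assoc, ← mul_assoc, this]

theorem mul_assoc' (P Q R : PsiDO d) : P * Q * R = P * (Q * R) := by
  obtain ⟨a, ha⟩ := P.bounded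
  obtain ⟨b, hb⟩ := Q.bounded
  obtain ⟨c, hc⟩ := R.bounded
  have hab : ∀ l, a + b < l → (P * Q).coeff l = 0 := mulCoeff_eq_zero ha hb
  have hbc : ∀ l, b + c < l → (Q * R).coeff l = 0 := mulCoeff_eq_zero hb hc
  refine ext_of_bound (a + b + c) (mulCoeff_eq_zero hab hc)
    (by rw [add_assoc]; exact mulCoeff_eq_zero ha hbc) fun n => ?_
  rw [coeff_mul, mulCoeff_eq_star hab hc, coeff_mul, add_assoc a b c, mulCoeff_eq_star ha hbc]
  have hl : ∀ i : ℕ, (P * Q).coeff (a + b - i) = star a b P Q i := fun i => by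
    rw [coeff_mul, mulCoeff_eq_star ha hb]
  have hr : ∀ i : ℕ, (Q * R).coeff (b + c - i) = star b c Q R i := fun i => by
    rw [coeff_mul, mulCoeff_eq_star hb hc]
  simp only [star, hl, hr, iter_sum, iter_smul, iter_mul, ← Function.iterate_add_apply,
    Finset.mul_sum, Finset.sum_mul, Finset.smul_sum]
  have key : ∀ (i r j s : ℕ) (X Y : F),
      Ring.choose (a + b - ((i + r + j : ℕ) : ℤ)) s • ((Ring.choose (a - i) r • X) * Y)
        = ∑ z ∈ Finset.HasAntidiagonal.antidiagonal s, (((r + z.1).choose r : ℤ)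
            * (Ring.choose (a - i) (r + z.1) * Ring.choose (b - j) z.2)) • (X * Y) := by
    intro i r j s X Y
    rw [← Finset.sum_smul, ← choose_identity, smul_mul_assoc, smul_smul,
      show a + b - ((i + r + j : ℕ) : ℤ) = a - i - r + (b - j) by push_cast; ring, mul_comm]
  have lhs : ∀ x : ℕ × ℕ, ∀ y : ℕ × ℕ, ∀ z ∈ Finset.HasAntidiagonal.antidiagonal y.1,
      ∀ w ∈ Finset.HasAntidiagonal.antidiagonal z.1,
      Ring.choose (a + b - (y.1 : ℤ)) y.2 •
        (Ring.choose (a - (w.1 : ℤ)) w.2 • (P.coeff (a - w.1) * d^[w.2] (Q.coeff (b - z.2)))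
          * d^[y.2] (R.coeff (c - x.2)))
      = ∑ v ∈ Finset.HasAntidiagonal.antidiagonal y.2, (((w.2 + v.1).choose w.2 : ℤ)
            * (Ring.choose (a - w.1) (w.2 + v.1) * Ring.choose (b - z.2) v.2)) •
            (P.coeff (a - w.1) * d^[w.2] (Q.coeff (b - z.2)) * d^[y.2] (R.coeff (c - x.2))) := by
    intro x y z hz w hw
    rw [Finset.HasAntidiagonal.mem_antidiagonal] at hz hw
    rw [← key, hw, hz]
  rw [Finset.sum_congr rfl fun x _ => Finset.sum_congr rfl fun y _ =>
    Finset.sum_congr rfl fun z hz => Finset.sum_congr rfl fun w hw => lhs x y z hz w hw]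
  simp only [Finset.sum_sigma']
  refine Finset.sum_bij'
    (i := fun T _ => ⟨(T.2.2.2.1.1 + T.2.2.2.1.2 + T.2.2.2.2.1, T.2.2.1.2 + T.2.2.2.2.2 + T.1.2),
      (T.2.2.2.1.1, T.2.2.2.1.2 + T.2.2.2.2.1), (T.2.2.1.2 + T.2.2.2.2.2, T.1.2),
      (T.2.2.1.2, T.2.2.2.2.2), (T.2.2.2.1.2, T.2.2.2.2.1)⟩)
    (j := fun T _ => ⟨(T.2.1.1 + T.2.2.2.2.1 + T.2.2.2.1.1 + (T.2.2.2.2.2 + T.2.2.2.1.2), T.2.2.1.2),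
      (T.2.1.1 + T.2.2.2.2.1 + T.2.2.2.1.1, T.2.2.2.2.2 + T.2.2.2.1.2),
      (T.2.1.1 + T.2.2.2.2.1, T.2.2.2.1.1), (T.2.1.1, T.2.2.2.2.1),
      (T.2.2.2.2.2, T.2.2.2.1.2)⟩) ?_ ?_ ?_ ?_ ?_
  · rintro ⟨⟨x1, x2⟩, ⟨y1, y2⟩, ⟨z1, z2⟩, ⟨w1, w2⟩, ⟨v1, v2⟩⟩ h
    simp only [Finset.mem_sigma, Finset.HasAntidiagonal.mem_antidiagonal, and_true] at h ⊢
    refine ⟨?_, ?_⟩ <;> omega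
  · rintro ⟨⟨x1, x2⟩, ⟨y1, y2⟩, ⟨z1, z2⟩, ⟨w1, w2⟩, ⟨v1, v2⟩⟩ h
    simp only [Finset.mem_sigma, Finset.HasAntidiagonal.mem_antidiagonal, and_true] at h ⊢
    omega
  · rintro ⟨⟨x1, x2⟩, ⟨y1, y2⟩, ⟨z1, z2⟩, ⟨w1, w2⟩, ⟨v1, v2⟩⟩ h
    simp only [Finset.mem_sigma, Finset.HasAntidiagonal.mem_antidiagonal] at h
    obtain ⟨h1, h2, h3, h4, h5⟩ := h
    simp only [Sigma.mk.injEq, Prod.mk.injEq, heq_eq_eq, and_true]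
    omega
  · rintro ⟨⟨x1, x2⟩, ⟨y1, y2⟩, ⟨z1, z2⟩, ⟨w1, w2⟩, ⟨v1, v2⟩⟩ h
    simp only [Finset.mem_sigma, Finset.HasAntidiagonal.mem_antidiagonal] at h
    obtain ⟨h1, h2, h3, h4, h5⟩ := h
    simp only [Sigma.mk.injEq, Prod.mk.injEq, heq_eq_eq, and_true, true_and]
    omega
  · rintro ⟨⟨x1, x2⟩, ⟨y1, y2⟩, ⟨z1, z2⟩, ⟨w1, w2⟩, ⟨v1, v2⟩⟩ h
    simp only [Finset.mem_sigma, Finset.HasAntidiagonal.mem_antidiagonal] at h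
    obtain ⟨h1, h2, h3, h4, h5⟩ := h
    subst h5
    simp only [zsmul_eq_mul, nsmul_eq_mul, Int.cast_mul, Int.cast_natCast]
    ring

instance : Ring (PsiDO d) where
  zero_add := zero_add
  add_zero := add_zero
  add_assoc := add_assoc
  add_comm := add_comm
  neg_add_cancel := neg_add_cancel
  sub_eq_add_neg := sub_eq_add_neg
  nsmul := (· • ·)
  nsmul_zero := AddMonoid.nsmul_zero
  nsmul_succ := AddMonoid.nsmul_succ
  zsmul := (· • ·)
  zsmul_zero' := SubNegMonoid.zsmul_zero'
  zsmul_succ' := SubNegMonoid.zsmul_succ'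
  zsmul_neg' := SubNegMonoid.zsmul_neg'
  left_distrib := left_distrib'
  right_distrib := right_distrib'
  mul_assoc := mul_assoc'
  one_mul := one_mul'
  mul_one := mul_one'
  zero_mul P := by
    have h := right_distrib' (0 : PsiDO d) 0 P
    rw [add_zero] at h
    exact left_eq_add.mp h
  mul_zero P := by
    have h := left_distrib' P (0 : PsiDO d) 0
    rw [add_zero] at h
    exact left_eq_add.mp h

/-- The strictly negative part `P_- = ∑_{l < 0} c_l ∂^l`. -/
def negPart (P : PsiDO d) : PsiDO d :=
  ⟨fun l => if l < 0 then P.coeff l else 0, -1, fun l hl => if_neg (by omega)⟩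

/-- The formal adjoint `P^* = ∑ (-1)^l ∂^l c_l`: its coefficient of `∂^m` is
`∑_r (-1)^(m + r) binom(m + r, r) d^r(c_(m + r))`, a finite sum. -/
def adjoint (P : PsiDO d) : PsiDO d :=
  ⟨fun m => ∑ᶠ r : ℕ, (((m + r).negOnePow : ℤ) * Ring.choose (m + (r : ℤ)) r) •
      d^[r] (P.coeff (m + r)), by
    obtain ⟨n, hn⟩ := P.bounded
    refine ⟨n, fun m hm => ?_⟩
    rw [← finsum_zero (α := ℕ)]
    refine finsum_congr fun r => ?_
    rw [hn _ (by omega), iter_zero, smul_zero]⟩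

/-- Apply a derivation `D` of the coefficient ring to every coefficient. -/
def mapCoeff (D : Derivation k F F) (P : PsiDO d) : PsiDO d :=
  ⟨fun l => D (P.coeff l), by
    obtain ⟨n, hn⟩ := P.bounded
    exact ⟨n, fun l hl => by simp only [hn l hl, map_zero]⟩⟩

/-- The operator `∂`, which is invertible. -/
def del : (PsiDO d)ˣ where
  val := mono 1 1
  inv := mono 1 (-1)
  val_inv := by rw [mono_mul_mono _ d.map_one_eq_zero, one_mul]; rfl
  inv_val := by rw [mono_mul_mono _ d.map_one_eq_zero, one_mul]; rfl

end PsiDO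

/-! ### Matrix operators depending on all time variables

The times are `t_n^j`, `j : Fin N`, `n` odd; `n = 2 i + 1` is coded by `i : ℕ`. The coefficients
are formal power series in all the times over `𝕜`. With `∂ = ∑_j a_j⁻¹ ∂/∂t_1^j` the times
`t_n^j`, `n ≥ 3`, commute with `∂`, so an operator is written as a power series in these central
variables whose coefficients are pseudo-differential operators over the power series in
`t_1^1, …, t_1^N`. This ring contains operators of infinite order such as the Orlov-Shulman
operator. -/

/-- Formal power series in `t_1^1, …, t_1^N`. -/
abbrev Fn (𝕜 : Type*) (N : ℕ) : Type _ := MvPowerSeries (Fin N) 𝕜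

section Operators

variable {𝕜 : Type*} [CommRing 𝕜] {N : ℕ}

/-- The derivation `∂ = ∑_j a_j⁻¹ ∂/∂t_1^j`. -/
def dx (a : Fin N → 𝕜ˣ) : Derivation 𝕜 (Fn 𝕜 N) (Fn 𝕜 N) :=
  ∑ j, ((a j)⁻¹ : 𝕜ˣ).val • MvPowerSeries.pderiv 𝕜 j

theorem dx_const (a : Fin N → 𝕜ˣ) (c : 𝕜) : dx a (MvPowerSeries.C c) = 0 :=
  (dx a).map_algebraMap c

/-- Scalar operators; the variable `(j, i)` stands for the time `t_{2i+3}^j`. -/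
abbrev Op (a : Fin N → 𝕜ˣ) : Type _ := MvPowerSeries (Fin N × ℕ) (PsiDO (dx a))

/-- Matrix operators: `N × N` matrices of scalar operators. -/
abbrev MatOp (a : Fin N → 𝕜ˣ) : Type _ := Matrix (Fin N) (Fin N) (Op a)

variable {a : Fin N → 𝕜ˣ}

/-- Apply a map of pseudo-differential operators to every coefficient of a scalar operator. -/
def Op.map (f : PsiDO (dx a) → PsiDO (dx a)) (w : Op a) : Op a :=
  fun τ => f (MvPowerSeries.coeff τ w)

/-- The derivative of a scalar operator with respect to the variable `p = (j, i)`, that is,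
with respect to `t_{2i+3}^j`. -/
def Op.deriv (p : Fin N × ℕ) (w : Op a) : Op a :=
  fun τ => (τ p + 1) • MvPowerSeries.coeff (τ + Finsupp.single p 1) w

/-- The scalar in `𝕜` which is the coefficient of the monomial `t_1^β t_{≥3}^τ ∂^l` in the
`(u, v)` entry of a matrix operator. -/
def entryCoeff (W : MatOp a) (u v : Fin N) (τ : Fin N × ℕ →₀ ℕ) (l : ℤ) (β : Fin N →₀ ℕ) : 𝕜 :=
  MvPowerSeries.coeff β ((MvPowerSeries.coeff τ (W u v)).coeff l)

/-- The strictly negative part `W_-` with respect to powers of `∂`. -/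
def negPart (W : MatOp a) : MatOp a := Matrix.map W (Op.map PsiDO.negPart)

/-- The formal adjoint `(∑ c_l ∂^l)^* = ∑ (-1)^l ∂^l c_lᵀ`. -/
def adjoint (W : MatOp a) : MatOp a := Matrix.map (Matrix.transpose W) (Op.map PsiDO.adjoint)

/-- The coefficientwise derivative `∂W/∂t_{2i+1}^j`. -/
def timeDeriv (j : Fin N) : ℕ → MatOp a → MatOp a
  | 0, W => Matrix.map W (Op.map (PsiDO.mapCoeff (MvPowerSeries.pderiv 𝕜 j)))
  | i + 1, W => Matrix.map W (Op.deriv (j, i))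

/-- `∂` times the identity matrix. -/
def delMat (a : Fin N → 𝕜ˣ) : (MatOp a)ˣ :=
  Units.map ((Matrix.scalar (Fin N)).comp (MvPowerSeries.C (σ := Fin N × ℕ) (R := PsiDO (dx a)))).toMonoidHom
    PsiDO.del

/-- The diagonal operator with entries `f_j ∂^l`. -/
def diagMono (a : Fin N → 𝕜ˣ) (f : Fin N → Fn 𝕜 N) (l : ℤ) : MatOp a :=
  Matrix.diagonal fun j => MvPowerSeries.C (PsiDO.mono (f j) l)

/-- `A∂` with `A = diag(a_1, …, a_N)`; it is invertible. -/
def ADel (a : Fin N → 𝕜ˣ) : (MatOp a)ˣ where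
  val := diagMono a (fun j => MvPowerSeries.C (a j : 𝕜)) 1
  inv := diagMono a (fun j => MvPowerSeries.C ((a j)⁻¹ : 𝕜ˣ).val) (-1)
  val_inv := by
    rw [diagMono, diagMono, Matrix.diagonal_mul_diagonal, ← Matrix.diagonal_one]
    congr 1
    funext j
    rw [← map_mul, PsiDO.mono_mul_mono _ (dx_const a _), ← map_mul, Units.mul_inv, map_one]
    rfl
  inv_val := by
    rw [diagMono, diagMono, Matrix.diagonal_mul_diagonal, ← Matrix.diagonal_one]
    congr 1
    funext j
    rw [← map_mul, PsiDO.mono_mul_mono _ (dx_const a _), ← map_mul, Units.inv_mul, map_one]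
    rfl

/-- The matrix unit `E_j = E_{jj}`. -/
def E (a : Fin N → 𝕜ˣ) (j : Fin N) : MatOp a := Matrix.single j j 1

/-- The terms `∑_i (2i+3) a_j^(2i+2) t_{2i+3}^j ∂^(2i+2)` of the operator `Γ`, as a power series in the
times `t_{2i+3}^j`. -/
def gamHigher (a : Fin N → 𝕜ˣ) (j : Fin N) : Op a := fun τ =>
  ∑ᶠ i : ℕ, if τ = Finsupp.single (j, i) 1 then
    PsiDO.mono (MvPowerSeries.C (((2 * i + 3 : ℕ) : 𝕜) * (a j : 𝕜) ^ (2 * i + 2))) (2 * i + 2) else 0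

/-- The operator `Γ = ∑_{n odd} ∑_j n t_n^j A^(n-1) E_{jj} ∂^(n-1)`. -/
def Gam (a : Fin N → 𝕜ˣ) : MatOp a :=
  Matrix.diagonal fun j => MvPowerSeries.C (PsiDO.mono (MvPowerSeries.X j) 0) + gamHigher a j

/-! ### The hierarchy -/

/-- The right-hand side `-((L^n R)_-) Φ` of a Sato equation, where `L = Φ Λ Φ⁻¹` and
`R = Φ e Φ⁻¹`, in any ring with a given "negative part" map. -/
def satoField {𝓡 : Type*} [Ring 𝓡] (neg : 𝓡 → 𝓡) (Λ e : 𝓡) (n : ℕ) (Φ : 𝓡ˣ) : 𝓡 :=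
  -neg ((Φ * Λ * (Φ⁻¹ : 𝓡ˣ)) ^ n * (Φ * e * (Φ⁻¹ : 𝓡ˣ))) * Φ

/-- `Φ` is a dressing operator of the `N`-component BKP hierarchy: it has the form
`1 + w_1 ∂⁻¹ + w_2 ∂⁻² + …`, it satisfies the B type condition `Φ^* = ∂ Φ⁻¹ ∂⁻¹`, and it satisfies
the Sato equations `∂Φ/∂t_n^j = -(L^n R_j)_- Φ` for all `j` and all odd `n`.
(Every operator `1 + w_1 ∂⁻¹ + …` is invertible, so asking for a unit is no restriction.) -/
structure IsDressing (Φ : (MatOp a)ˣ) : Prop where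
  form : negPart (Φ - 1 : MatOp a) = Φ - 1
  bType : adjoint (Φ : MatOp a) = delMat a * (Φ⁻¹ : (MatOp a)ˣ) * ((delMat a)⁻¹ : (MatOp a)ˣ)
  sato : ∀ (j : Fin N) (i : ℕ),
    timeDeriv j i (Φ : MatOp a) = satoField negPart (ADel a) (E a j) (2 * i + 1) Φ

/-- The Lax operator `L = Φ A ∂ Φ⁻¹`. -/
def lax (Φ : (MatOp a)ˣ) : (MatOp a)ˣ := Φ * ADel a * Φ⁻¹

/-- The operator `R_j = Φ E_j Φ⁻¹`. -/
def projR (Φ : (MatOp a)ˣ) (j : Fin N) : MatOp a := Φ * E a j * (Φ⁻¹ : (MatOp a)ˣ)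

/-- The Orlov-Shulman operator `M = Φ Γ Φ⁻¹`. -/
def orlov (Φ : (MatOp a)ˣ) : MatOp a := Φ * Gam a * (Φ⁻¹ : (MatOp a)ˣ)

/-! ### The additional flows -/

/-- `B_{psj} = M^p L^s R_j - (-1)^s R_j L^(s-1) M^p L`. -/
def addB (Φ : (MatOp a)ˣ) (p s : ℕ) (j : Fin N) : MatOp a :=
  orlov Φ ^ p * (lax Φ : MatOp a) ^ s * projR Φ j
    - (-1) ^ s * projR Φ j * (lax Φ ^ ((s : ℤ) - 1) : (MatOp a)ˣ) * orlov Φ ^ p * lax Φ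

/-- `X` is the negative part of
`D_{mnj} = e^(mM) q^(nL) R_j - L⁻¹ R_j q^(-nL) e^(mM) L = ∑_{p,s} m^p (n log q)^s / (p! s!) B_{psj}`,
the double series converging coefficient by coefficient; `c` is `log q`. -/
def IsNegPartD [Algebra ℚ 𝕜] [TopologicalSpace 𝕜] (c : 𝕜) (Φ : (MatOp a)ˣ) (m n : ℕ) (j : Fin N)
    (X : MatOp a) : Prop :=
  ∀ (u v : Fin N) (τ : Fin N × ℕ →₀ ℕ) (l : ℤ) (β : Fin N →₀ ℕ),
    HasSum (fun x : ℕ × ℕ =>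
      ((m : 𝕜) ^ x.1 * ((n : 𝕜) * c) ^ x.2
          * algebraMap ℚ 𝕜 (1 / (Nat.factorial x.1 * Nat.factorial x.2)))
        * entryCoeff (negPart (addB Φ x.1 x.2 j)) u v τ l β)
      (entryCoeff X u v τ l β)

/-! ### Commutators of flows

A flow `∂_*` acts on expressions in `Φ` through the first variation: if `∂_* Φ = δ`, then `∂_* F(Φ)`
is the coefficient of `ε` in `F(Φ + ε δ)`, `ε² = 0`. -/

/-- The unit `Φ + ε δ` of the dual numbers over a ring. -/
def perturb {𝓡 : Type*} [Ring 𝓡] (Φ : 𝓡ˣ) (δ : 𝓡) : (DualNumber 𝓡)ˣ where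
  val := TrivSqZeroExt.inl (Φ : 𝓡) + TrivSqZeroExt.inr δ
  inv := TrivSqZeroExt.inl ((Φ⁻¹ : 𝓡ˣ) : 𝓡) - TrivSqZeroExt.inr ((Φ⁻¹ : 𝓡ˣ) * δ * (Φ⁻¹ : 𝓡ˣ))
  val_inv := by
    ext <;> simp [mul_assoc]
  inv_val := by
    ext <;> simp [mul_assoc]

/-- The negative part over the dual numbers, `(W + ε V)_- = W_- + ε V_-`. -/
def negPartDual (W : DualNumber (MatOp a)) : DualNumber (MatOp a) :=
  TrivSqZeroExt.inl (negPart W.fst) + TrivSqZeroExt.inr (negPart W.snd)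

/-- `∂_*(∂Φ/∂t_{2i+1}^j)` for a flow with `∂_* Φ = δ`: the first variation of the right-hand side
`-(L^n R_j)_- Φ` of the Sato equation, `n = 2i+1`. -/
def satoVariation (Φ : (MatOp a)ˣ) (δ : MatOp a) (j : Fin N) (i : ℕ) : MatOp a :=
  (satoField negPartDual (TrivSqZeroExt.inl (ADel a : MatOp a)) (TrivSqZeroExt.inl (E a j))
    (2 * i + 1) (perturb Φ δ)).snd

/-- The commutator `[∂_*, ∂/∂t_{2i+1}^j] Φ = ∂_*(∂Φ/∂t_{2i+1}^j) - ∂(∂_* Φ)/∂t_{2i+1}^j`, on a solution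
`Φ` of the Sato equations, for a flow with `∂_* Φ = δ`. -/
def flowCommutator (Φ : (MatOp a)ˣ) (δ : MatOp a) (j : Fin N) (i : ℕ) : MatOp a :=
  satoVariation Φ δ j i - timeDeriv j i δ

end Operators

end BKP

end

noncomputable section

namespace BKP

open Finset.HasAntidiagonal (antidiagonal)

/-! ### Scalar operators: coefficientwise derivations and the splitting by sign of the order -/

namespace PsiDO

variable {k F : Type*} [CommRing k] [CommRing F] [Algebra k F] {d : Derivation k F F}

/-! Fix j and an odd n, and write C = L^n R_j = C_+ + C_-, with C_- the negative part. Both halves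
of the splitting are closed under multiplication.

Commutation. The bare operators K = A∂, E_s and Γ all satisfy ∂K/∂t_n^j = [A^n E_jj ∂^n, K]. For the
first two both sides vanish; for Γ the identity comes from [∂, t_1^j] = a_j⁻¹, which gives [a_j^n
∂^n, t_1^j] = n a_j^(n-1) ∂^(n-1). Dressing with Φ and using the Sato equation turns this into
∂Y/∂t_n^j = [C_+, Y] for Y = L, R_s, M (`conj_mem_innerSubring`). Elements with this property form a
subring closed under inverses, so every B_{prs} has it too. Taking negative parts, [C_+, B]_- =
[C_+, B_-]_-, so B_- satisfies a closed linear equation. The sum X = (D_{lks})_- satisfies the same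
equation, because multiplication by a fixed operator is coefficientwise continuous on families of
order at most -1. The first variation of the Sato equation along -XΦ then makes the commutator equal
to ([C_-, X] - [C, X]_- + [C_+, X]_-)Φ = ([C_-, X] - [C_-, X]_-)Φ, which vanishes because C_- and X
are negative (`flowCommutator_eq_zero`).

Convergence. Give t_n^j weight n and ∂ weight -1. Then Φ and Φ⁻¹ have only terms of weight at least
0, Γ of weight at least 1, A∂ of weight -1, so B_{prs} has only terms of weight at least p - r
(`IsDressing.addB_mem_matFil`). A fixed monomial has fixed weight, hence bounds p in terms of r.
Since (k ħ)^r is divisible by ħ^r, a fixed power of ħ bounds r. Each coefficient is therefore a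
finite sum. -/

@[simp] theorem coeff_sum {ι : Type*} (s : Finset ι) (f : ι → PsiDO d) (l : ℤ) :
    (∑ i ∈ s, f i).coeff l = ∑ i ∈ s, (f i).coeff l :=
  map_sum (⟨⟨fun P : PsiDO d => P.coeff l, rfl⟩, fun _ _ => rfl⟩ : PsiDO d →+ F) f s

theorem coeff_negPart (P : PsiDO d) (l : ℤ) :
    (negPart P).coeff l = if l < 0 then P.coeff l else 0 := rfl

theorem coeff_mapCoeff (D : Derivation k F F) (P : PsiDO d) (l : ℤ) :
    (mapCoeff D P).coeff l = D (P.coeff l) := rfl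

theorem mapCoeff_mono (D : Derivation k F F) (f : F) (l : ℤ) :
    mapCoeff D (mono f l : PsiDO d) = mono (D f) l := by
  ext m
  rw [coeff_mapCoeff, coeff_mono, coeff_mono]
  split_ifs <;> simp

/-- The product involves iterates d^r of the coefficients of Q, so the Leibniz rule needs D to
commute with d. -/
theorem mapCoeff_mul {D : Derivation k F F} (hD : Function.Commute D d) (P Q : PsiDO d) :
    mapCoeff D (P * Q) = mapCoeff D P * Q + P * mapCoeff D Q := by
  obtain ⟨a, ha⟩ := P.bounded
  obtain ⟨b, hb⟩ := Q.bounded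
  have ha' : ∀ l, a < l → (mapCoeff D P).coeff l = 0 := fun l hl => by
    rw [coeff_mapCoeff, ha l hl, map_zero]
  have hb' : ∀ l, b < l → (mapCoeff D Q).coeff l = 0 := fun l hl => by
    rw [coeff_mapCoeff, hb l hl, map_zero]
  refine ext_of_bound (a + b) (fun l hl => ?_) (fun l hl => ?_) fun n => ?_
  · rw [coeff_mapCoeff, coeff_mul, mulCoeff_eq_zero ha hb l hl, map_zero]
  · rw [coeff_add, coeff_mul, coeff_mul, mulCoeff_eq_zero ha' hb l hl,
      mulCoeff_eq_zero ha hb' l hl, add_zero]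
  · rw [coeff_add, coeff_mapCoeff, coeff_mul, coeff_mul, coeff_mul, mulCoeff_eq_star ha hb,
      mulCoeff_eq_star ha' hb, mulCoeff_eq_star ha hb']
    simp only [star, map_sum, ← Finset.sum_add_distrib]
    refine Finset.sum_congr rfl fun x _ => Finset.sum_congr rfl fun y _ => ?_
    rw [map_zsmul, Derivation.leibniz, coeff_mapCoeff, coeff_mapCoeff, (hD.iterate_right y.2).eq,
      ← smul_add, smul_eq_mul, smul_eq_mul, add_comm, mul_comm (d^[y.2] _)]

theorem negPart_eq_self_iff {P : PsiDO d} : negPart P = P ↔ ∀ l, -1 < l → P.coeff l = 0 := by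
  constructor
  · intro h l hl
    rw [← h, coeff_negPart, if_neg (by omega)]
  · intro h
    ext l
    rw [coeff_negPart]
    split_ifs with hl
    · rfl
    · exact (h l (by omega)).symm

theorem negPart_eq_zero_iff {P : PsiDO d} : negPart P = 0 ↔ ∀ l < 0, P.coeff l = 0 := by
  constructor
  · intro h l hl
    have := congrArg (coeff · l) h
    simpa [coeff_negPart, hl] using this
  · intro h
    ext l
    rw [coeff_negPart]
    split_ifs with hl
    · exact h l hl
    · rfl

theorem negPart_add (P Q : PsiDO d) : negPart (P + Q) = negPart P + negPart Q := by
  ext l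
  simp only [coeff_negPart, coeff_add]
  split_ifs <;> simp

/-- Taking the strictly negative part, as a homomorphism. -/
def negPartHom : PsiDO d →+ PsiDO d where
  toFun := negPart
  map_zero' := negPart_eq_zero_iff.2 fun _ _ => rfl
  map_add' := negPart_add

theorem negPart_sum {ι : Type*} (s : Finset ι) (f : ι → PsiDO d) :
    negPart (∑ i ∈ s, f i) = ∑ i ∈ s, negPart (f i) :=
  map_sum negPartHom f s

theorem negPart_negPart (P : PsiDO d) : negPart (negPart P) = negPart P :=
  negPart_eq_self_iff.2 fun l hl => by rw [coeff_negPart, if_neg (by omega)]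

/-- Operators of negative order form a (non-unital) subring. -/
theorem negPart_mul_of_neg {P Q : PsiDO d} (hP : negPart P = P) (hQ : negPart Q = Q) :
    negPart (P * Q) = P * Q :=
  negPart_eq_self_iff.2 fun l hl => by
    rw [coeff_mul, mulCoeff_eq_zero (negPart_eq_self_iff.1 hP) (negPart_eq_self_iff.1 hQ) l
      (by omega)]

/-- Differential operators form a subring. -/
theorem negPart_mul_of_nonneg {P Q : PsiDO d} (hP : negPart P = 0) (hQ : negPart Q = 0) :
    negPart (P * Q) = 0 := by
  rw [negPart_eq_zero_iff] at hP hQ ⊢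
  intro m hm
  rw [coeff_mul, mulCoeff, ← finsum_zero (α := ℤ × ℕ)]
  refine finsum_congr fun ⟨l, r⟩ => ?_
  by_cases hl : l < 0
  · rw [hP l hl, zero_mul, smul_zero]
  by_cases hr : m - l + r < 0
  · rw [hQ _ hr, iter_zero, mul_zero, smul_zero]
  · lift l to ℕ using not_lt.1 hl
    -- Here l ≥ 0, m < 0 and m - l + r ≥ 0 force r > l, so the binomial coefficient vanishes.
    rw [Ring.choose_natCast, Nat.choose_eq_zero_of_lt (by omega), Nat.cast_zero, zero_smul]

end PsiDO

/-! ### Commuting derivations, time derivatives and negative parts of matrix operators -/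

section Operators

variable {𝕜 : Type*} [CommRing 𝕜] {N : ℕ} {a : Fin N → 𝕜ˣ}

theorem pderiv_comm (i j : Fin N) (f : Fn 𝕜 N) :
    MvPowerSeries.pderiv 𝕜 i (MvPowerSeries.pderiv 𝕜 j f)
      = MvPowerSeries.pderiv 𝕜 j (MvPowerSeries.pderiv 𝕜 i f) := by
  by_cases h : i = j
  · rw [h]
  ext n
  simp only [MvPowerSeries.coeff_pderiv, Finsupp.add_apply, Finsupp.single_apply, if_neg h,
    if_neg (Ne.symm h), add_zero]
  rw [add_right_comm, mul_right_comm]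

theorem dx_apply (a : Fin N → 𝕜ˣ) (f : Fn 𝕜 N) :
    dx a f = ∑ j, ((a j)⁻¹ : 𝕜ˣ).val • MvPowerSeries.pderiv 𝕜 j f := by
  rw [dx, ← Derivation.coeFnAddMonoidHom_apply, map_sum, Finset.sum_apply]
  rfl

theorem pderiv_commute_dx (a : Fin N → 𝕜ˣ) (j : Fin N) :
    Function.Commute (MvPowerSeries.pderiv 𝕜 j : Derivation 𝕜 (Fn 𝕜 N) (Fn 𝕜 N)) (dx a) := by
  intro f
  simp only [dx_apply, map_sum, Derivation.map_smul, pderiv_comm j]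

theorem dx_X (a : Fin N → 𝕜ˣ) (j : Fin N) :
    dx a (MvPowerSeries.X j) = MvPowerSeries.C ((a j)⁻¹ : 𝕜ˣ).val := by
  rw [dx_apply, Finset.sum_eq_single j]
  · rw [MvPowerSeries.pderiv_X_self, MvPowerSeries.smul_eq_C_mul, mul_one]
  · intro i _ hi
    rw [MvPowerSeries.pderiv_X_of_ne (Ne.symm hi), smul_zero]
  · simp

/-! ### Derivations of matrix operators -/

theorem coeff_matMul (V W : MatOp a) (u v : Fin N) (τ : Fin N × ℕ →₀ ℕ) :
    MvPowerSeries.coeff τ ((V * W) u v) = ∑ w, ∑ x ∈ antidiagonal τ,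
      MvPowerSeries.coeff x.1 (V u w) * MvPowerSeries.coeff x.2 (W w v) := by
  classical
  simp only [Matrix.mul_apply, map_sum, MvPowerSeries.coeff_mul]

theorem coeff_opMap (f : PsiDO (dx a) → PsiDO (dx a)) (w : Op a) (τ : Fin N × ℕ →₀ ℕ) :
    MvPowerSeries.coeff τ (Op.map f w) = f (MvPowerSeries.coeff τ w) := rfl

theorem coeff_opDeriv (p : Fin N × ℕ) (w : Op a) (τ : Fin N × ℕ →₀ ℕ) :
    MvPowerSeries.coeff τ (Op.deriv p w)
      = (τ p + 1) • MvPowerSeries.coeff (τ + Finsupp.single p 1) w := rfl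

theorem coeff_negPart (W : MatOp a) (u v : Fin N) (τ : Fin N × ℕ →₀ ℕ) :
    MvPowerSeries.coeff τ (negPart W u v) = (MvPowerSeries.coeff τ (W u v)).negPart := rfl

/-- The derivation of scalar operators with respect to the time `t_{2i+1}^j`. -/
def opTimeDeriv (j : Fin N) : ℕ → Op a → Op a
  | 0 => Op.map (PsiDO.mapCoeff (MvPowerSeries.pderiv 𝕜 j))
  | i + 1 => Op.deriv (j, i)

theorem timeDeriv_apply (j : Fin N) (i : ℕ) (W : MatOp a) (u v : Fin N) :
    timeDeriv j i W u v = opTimeDeriv j i (W u v) := by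
  cases i <;> rfl

theorem opTimeDeriv_add (j : Fin N) (i : ℕ) (v w : Op a) :
    opTimeDeriv j i (v + w) = opTimeDeriv j i v + opTimeDeriv j i w := by
  ext τ l
  cases i with
  | zero => simp [opTimeDeriv, coeff_opMap, PsiDO.coeff_mapCoeff]
  | succ i => simp [opTimeDeriv, coeff_opDeriv]

theorem opTimeDeriv_mapCoeff_mul (j : Fin N) (v w : Op a) :
    opTimeDeriv j 0 (v * w) = opTimeDeriv j 0 v * w + v * opTimeDeriv j 0 w := by
  classical
  ext τ : 1
  have hsum : ∀ (s : Finset ((Fin N × ℕ →₀ ℕ) × (Fin N × ℕ →₀ ℕ))) (f : _ → PsiDO (dx a)),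
      PsiDO.mapCoeff (MvPowerSeries.pderiv 𝕜 j) (∑ x ∈ s, f x)
        = ∑ x ∈ s, PsiDO.mapCoeff (MvPowerSeries.pderiv 𝕜 j) (f x) := fun s f => by
    ext l : 1
    simp only [PsiDO.coeff_mapCoeff, PsiDO.coeff_sum, map_sum]
  simp only [opTimeDeriv, map_add, MvPowerSeries.coeff_mul, coeff_opMap, hsum,
    PsiDO.mapCoeff_mul (pderiv_commute_dx a j), Finset.sum_add_distrib]

/-- Index shift behind the Leibniz rule for ∂/∂t: pairs on the left that are not of the shifted form
have `x.1 p = 0` and carry weight zero. -/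
theorem sum_antidiagonal_add_single {ι M : Type*} [DecidableEq ι] [AddCommMonoid M] (p : ι)
    (f : (ι →₀ ℕ) → (ι →₀ ℕ) → M) (τ : ι →₀ ℕ) :
    ∑ x ∈ antidiagonal (τ + Finsupp.single p 1), (x : (ι →₀ ℕ) × (ι →₀ ℕ)).1 p • f x.1 x.2
      = ∑ x ∈ antidiagonal τ, (x.1 p + 1) • f (x.1 + Finsupp.single p 1) x.2 := by
  symm
  refine Finset.sum_of_injOn (fun x => (x.1 + Finsupp.single p 1, x.2)) ?_ ?_ ?_ ?_
  · rintro ⟨x, y⟩ _ ⟨x', y'⟩ _ h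
    simpa using h
  · rintro ⟨x, y⟩ h
    simp only [Finset.mem_coe, Finset.HasAntidiagonal.mem_antidiagonal] at h ⊢
    rw [← h, add_right_comm]
  · rintro ⟨x, y⟩ h h'
    simp only [Finset.HasAntidiagonal.mem_antidiagonal] at h
    have : x p = 0 := by
      by_contra hx
      refine h' ⟨(x - Finsupp.single p 1, y), ?_, ?_⟩
      · have hle : Finsupp.single p 1 ≤ x := by
          rw [Finsupp.single_le_iff]
          omega
        simp only [Finset.mem_coe, Finset.HasAntidiagonal.mem_antidiagonal]
        apply add_right_cancel (b := Finsupp.single p 1)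
        rw [add_right_comm, tsub_add_cancel_of_le hle, h]
      · have hle : Finsupp.single p 1 ≤ x := by
          rw [Finsupp.single_le_iff]
          omega
        simp only [tsub_add_cancel_of_le hle]
    simp [this]
  · rintro ⟨x, y⟩ _
    simp

theorem opDeriv_mul (p : Fin N × ℕ) (v w : Op a) :
    Op.deriv p (v * w) = Op.deriv p v * w + v * Op.deriv p w := by
  classical
  ext τ : 1
  have h2 := sum_antidiagonal_add_single p (fun x y =>
    MvPowerSeries.coeff y v * MvPowerSeries.coeff x w) τ
  rw [Finsupp.sum_antidiagonal_swap (τ + Finsupp.single p 1) fun x y => x p •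
      (MvPowerSeries.coeff y v * MvPowerSeries.coeff x w),
    Finsupp.sum_antidiagonal_swap τ fun x y => (x p + 1) •
      (MvPowerSeries.coeff y v * MvPowerSeries.coeff (x + Finsupp.single p 1) w)] at h2
  have h1 := sum_antidiagonal_add_single p (fun x y =>
    MvPowerSeries.coeff x v * MvPowerSeries.coeff y w) τ
  rw [map_add, coeff_opDeriv, MvPowerSeries.coeff_mul, MvPowerSeries.coeff_mul,
    MvPowerSeries.coeff_mul]
  simp only [coeff_opDeriv, smul_mul_assoc, mul_smul_comm]
  rw [← h1, ← h2, ← Finset.sum_add_distrib, Finset.smul_sum]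
  refine Finset.sum_congr rfl fun x hx => ?_
  rw [Finset.HasAntidiagonal.mem_antidiagonal] at hx
  have := DFunLike.congr_fun hx p
  rw [← add_smul]
  -- The factor τ p + 1 from differentiating the product splits as x.1 p + x.2 p, one summand for
  -- each Leibniz term.
  congr 1
  simpa using this.symm

theorem opTimeDeriv_mul (j : Fin N) (i : ℕ) (v w : Op a) :
    opTimeDeriv j i (v * w) = opTimeDeriv j i v * w + v * opTimeDeriv j i w := by
  cases i with
  | zero => exact opTimeDeriv_mapCoeff_mul j v w
  | succ i => exact opDeriv_mul (j, i) v w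

/-- The derivation with respect to a time, as a homomorphism. -/
def opTimeDerivHom (j : Fin N) (i : ℕ) : Op a →+ Op a :=
  AddMonoidHom.mk' (opTimeDeriv j i) (opTimeDeriv_add j i)

theorem timeDeriv_add (j : Fin N) (i : ℕ) (V W : MatOp a) :
    timeDeriv j i (V + W) = timeDeriv j i V + timeDeriv j i W := by
  ext u v : 1
  simp only [Matrix.add_apply, timeDeriv_apply, opTimeDeriv_add]

theorem timeDeriv_mul (j : Fin N) (i : ℕ) (V W : MatOp a) :
    timeDeriv j i (V * W) = timeDeriv j i V * W + V * timeDeriv j i W := by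
  ext u v : 1
  rw [Matrix.add_apply, timeDeriv_apply, Matrix.mul_apply, Matrix.mul_apply, Matrix.mul_apply,
    ← Finset.sum_add_distrib]
  simp only [timeDeriv_apply, ← opTimeDeriv_mul]
  exact map_sum (opTimeDerivHom j i) (fun w => V u w * W w v) Finset.univ

/-- The derivation of matrix operators with respect to a time, as a homomorphism. -/
def timeDerivHom (j : Fin N) (i : ℕ) : MatOp a →+ MatOp a :=
  AddMonoidHom.mk' (timeDeriv j i) (timeDeriv_add j i)

theorem timeDeriv_neg (j : Fin N) (i : ℕ) (V : MatOp a) :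
    timeDeriv j i (-V) = -timeDeriv j i V :=
  map_neg (timeDerivHom j i) V

theorem timeDeriv_negPart (j : Fin N) (i : ℕ) (W : MatOp a) :
    timeDeriv j i (negPart W) = negPart (timeDeriv j i W) := by
  ext u v τ l : 3
  rw [coeff_negPart, timeDeriv_apply, timeDeriv_apply, PsiDO.coeff_negPart]
  cases i with
  | zero =>
    simp only [opTimeDeriv, coeff_opMap, coeff_negPart, PsiDO.coeff_mapCoeff, PsiDO.coeff_negPart]
    split_ifs <;> simp
  | succ i =>
    have h : ∀ (n : ℕ) (P : PsiDO (dx a)), (n • P).coeff l = n • P.coeff l := fun _ _ => rfl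
    simp only [opTimeDeriv, coeff_opDeriv, coeff_negPart, h, PsiDO.coeff_negPart]
    split_ifs <;> simp

/-! ### Negative parts of matrix operators -/

theorem negPart_add (V W : MatOp a) : negPart (V + W) = negPart V + negPart W := by
  ext u v τ : 2
  simp only [coeff_negPart, Matrix.add_apply, map_add, PsiDO.negPart_add]

/-- Taking the strictly negative part, as a homomorphism. -/
def negPartHom : MatOp a →+ MatOp a := AddMonoidHom.mk' negPart negPart_add

theorem negPart_sub (V W : MatOp a) : negPart (V - W) = negPart V - negPart W :=
  map_sub negPartHom V W

theorem negPart_negPart (W : MatOp a) : negPart (negPart W) = negPart W := by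
  ext u v τ : 2
  simp only [coeff_negPart, PsiDO.negPart_negPart]

theorem negPart_mul_of_neg {V W : MatOp a} (hV : negPart V = V) (hW : negPart W = W) :
    negPart (V * W) = V * W := by
  ext u v τ : 2
  rw [coeff_negPart, coeff_matMul, PsiDO.negPart_sum]
  refine Finset.sum_congr rfl fun w _ => ?_
  rw [PsiDO.negPart_sum]
  refine Finset.sum_congr rfl fun x _ => PsiDO.negPart_mul_of_neg ?_ ?_
  · rw [← coeff_negPart, hV]
  · rw [← coeff_negPart, hW]

theorem negPart_mul_of_nonneg {V W : MatOp a} (hV : negPart V = 0) (hW : negPart W = 0) :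
    negPart (V * W) = 0 := by
  ext u v τ : 2
  rw [coeff_negPart, coeff_matMul, PsiDO.negPart_sum]
  refine Finset.sum_eq_zero fun w _ => ?_
  rw [PsiDO.negPart_sum]
  refine Finset.sum_eq_zero fun x _ => PsiDO.negPart_mul_of_nonneg ?_ ?_
  · rw [← coeff_negPart, hV]; rfl
  · rw [← coeff_negPart, hW]; rfl

/-- Replacing W by its negative part changes the commutator only by products of P with W - W_-, both
without negative part; such products have none either. This is what closes the evolution equation on
negative parts. -/
theorem negPart_commutator_negPart {P : MatOp a} (hP : negPart P = 0) (W : MatOp a) :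
    negPart (P * negPart W - negPart W * P) = negPart (P * W - W * P) := by
  have hW : negPart (W - negPart W) = 0 := by rw [negPart_sub, negPart_negPart, sub_self]
  have h1 := negPart_mul_of_nonneg hP hW
  have h2 := negPart_mul_of_nonneg hW hP
  rw [mul_sub, negPart_sub, sub_eq_zero] at h1
  rw [sub_mul, negPart_sub, sub_eq_zero] at h2
  rw [negPart_sub, negPart_sub, h1, h2]

end Operators

/-! ### Commutators and powers of monomial operators -/

namespace PsiDO

variable {k F : Type*} [CommRing k] [CommRing F] [Algebra k F] {d : Derivation k F F}

/-- In the expansion of c ∂^n f the r = 0 term cancels against f c ∂^n and the terms with r ≥ 2 die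
because d²f = 0, leaving r = 1. Used with f = t_1^j, on which ∂ is constant. -/
theorem mono_commutator {c f : F} (hc : d c = 0) (hf : d (d f) = 0) (n : ℤ) :
    (mono c n * mono f 0 - mono f 0 * mono c n : PsiDO d) = mono (n • (c * d f)) (n - 1) := by
  ext m
  rw [coeff_sub, coeff_mul_mono _ hc, coeff_mul, mulCoeff_mono_left,
    finsum_eq_sum_of_support_subset (s := Finset.range 2)]
  · rw [Finset.sum_range_succ, Finset.sum_range_one]
    simp only [coeff_mono, Ring.choose_zero_right, one_smul, Function.iterate_zero, id,
      Ring.choose_one_right, Function.iterate_one, Nat.cast_zero, Nat.cast_one, add_zero]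
    by_cases h1 : m = n
    · subst h1
      rw [if_neg (show ¬ m = m - 1 by omega)]
      simp [mul_comm]
    · by_cases h2 : m = n - 1
      · subst h2
        simp
      · rw [if_neg (by omega), if_neg (by omega), if_neg h2]
        simp
  · intro r hr
    rw [Function.mem_support] at hr
    by_contra hr'
    rw [Finset.coe_range, Set.mem_Iio, not_lt] at hr'
    obtain ⟨r, rfl⟩ := Nat.exists_eq_add_of_le' hr'
    refine hr ?_
    have : d^[r + 2] ((mono f 0 : PsiDO d).coeff (m - n + (r + 2 : ℕ))) = 0 := by
      rw [coeff_mono]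
      split_ifs
      · rw [Function.iterate_add_apply]
        simp only [Function.iterate_succ, Function.iterate_zero, Function.comp_apply, id, hf,
          iter_zero]
      · exact iter_zero _
    rw [this, mul_zero, smul_zero]

theorem mono_pow {c : F} (hc : d c = 0) (l : ℤ) (n : ℕ) :
    (mono c l : PsiDO d) ^ n = mono (c ^ n) (n * l) := by
  induction n with
  | zero => simp only [pow_zero, Nat.cast_zero, zero_mul]; rfl
  | succ n ih =>
    rw [pow_succ, ih, mono_mul_mono _ hc, pow_succ]
    congr 1
    push_cast
    ring

end PsiDO

/-! ### Derivations that act as commutators on dressed operators -/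

section Ring

variable {𝓡 : Type*} [Ring 𝓡]

/-- The subring on which a derivation `D` agrees with the commutator with `P`. -/
def innerSubring (D : 𝓡 →+ 𝓡) (hD : ∀ x y, D (x * y) = D x * y + x * D y) (P : 𝓡) :
    Subring 𝓡 where
  carrier := {x | D x = P * x - x * P}
  mul_mem' {x y} hx hy := by
    rw [Set.mem_ofPred_eq] at *
    rw [hD, hx, hy]
    noncomm_ring
  one_mem' := by
    have := hD 1 1
    rw [one_mul, mul_one, one_mul, left_eq_add] at this
    rw [Set.mem_ofPred_eq, this, mul_one, one_mul, sub_self]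
  add_mem' {x y} hx hy := by
    rw [Set.mem_ofPred_eq] at *
    rw [map_add, hx, hy]
    noncomm_ring
  zero_mem' := by simp
  neg_mem' {x} hx := by
    rw [Set.mem_ofPred_eq] at *
    rw [map_neg, hx]
    noncomm_ring

variable {D : 𝓡 →+ 𝓡} {hD : ∀ x y, D (x * y) = D x * y + x * D y} {P : 𝓡}

theorem mem_innerSubring {x : 𝓡} : x ∈ innerSubring D hD P ↔ D x = P * x - x * P := Iff.rfl

/-- Differentiating u u⁻¹ = 1 determines the derivative of u⁻¹. It is needed for the power L^(r-1)
at r = 0. -/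
theorem inv_mem_innerSubring {u : 𝓡ˣ} (hu : (u : 𝓡) ∈ innerSubring D hD P) :
    ((u⁻¹ : 𝓡ˣ) : 𝓡) ∈ innerSubring D hD P := by
  have h1 := (innerSubring D hD P).one_mem
  rw [mem_innerSubring] at hu h1 ⊢
  rw [mul_one, one_mul, sub_self, ← u.mul_inv, hD, hu, sub_mul, mul_assoc P, u.mul_inv,
    mul_one] at h1
  rw [← Units.mul_right_inj u, eq_neg_of_add_eq_zero_right h1]
  simp only [mul_sub, ← mul_assoc, u.mul_inv, one_mul]
  abel

theorem zpow_mem_innerSubring {u : 𝓡ˣ} (hu : (u : 𝓡) ∈ innerSubring D hD P) (n : ℤ) :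
    ((u ^ n : 𝓡ˣ) : 𝓡) ∈ innerSubring D hD P := by
  induction n with
  | zero => simp
  | succ n ih =>
    rw [zpow_add_one, Units.val_mul]
    exact mul_mem ih hu
  | pred n ih =>
    rw [zpow_sub_one, Units.val_mul]
    exact mul_mem ih (inv_mem_innerSubring hu)

/-- This produces the Lax equations from the Sato equation: with C the bare operator and V the
negative part of its dressing, the commutator is taken with the nonnegative part. -/
theorem conj_mem_innerSubring {Φ : 𝓡ˣ} {C V K : 𝓡} (hΦ : D Φ = -V * Φ)
    (hK : D K = C * K - K * C) :
    Φ * K * (Φ⁻¹ : 𝓡ˣ) ∈ innerSubring D hD (Φ * C * (Φ⁻¹ : 𝓡ˣ) - V) := by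
  rw [mem_innerSubring]
  generalize hY : Φ * K * (Φ⁻¹ : 𝓡ˣ) = Y
  generalize hQ : Φ * C * (Φ⁻¹ : 𝓡ˣ) = Q
  have hY' : Y * Φ = Φ * K := by rw [← hY, Units.inv_mul_cancel_right]
  have hQ' : Q * Φ = Φ * C := by rw [← hQ, Units.inv_mul_cancel_right]
  -- Differentiating YΦ = ΦK instead of Y = ΦKΦ⁻¹ avoids the derivative of Φ⁻¹; the claim is then
  -- checked after right multiplication by Φ.
  have h := hD Y Φ
  rw [hY', hD, hΦ, hK, ← sub_eq_iff_eq_add] at h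
  rw [← Units.mul_left_inj Φ, ← h]
  have h1 : Q * Y * Φ = Φ * C * K := by rw [mul_assoc, hY', ← mul_assoc, hQ']
  have h2 : Y * Q * Φ = Φ * K * C := by rw [mul_assoc, hQ', ← mul_assoc, hY']
  have h3 : V * Y * Φ = V * Φ * K := by rw [mul_assoc, hY', ← mul_assoc]
  simp only [sub_mul, mul_sub, h1, h2, h3, neg_mul, mul_neg, ← mul_assoc]
  abel

theorem satoField_eq (neg : 𝓡 → 𝓡) (Λ e : 𝓡) (n : ℕ) (Φ : 𝓡ˣ) :
    satoField neg Λ e n Φ = -neg (Φ * (Λ ^ n * e) * (Φ⁻¹ : 𝓡ˣ)) * Φ := by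
  rw [satoField, Units.conj_pow]
  simp only [mul_assoc, Units.inv_mul_cancel_left]

end Ring

section Operators

variable {𝕜 : Type*} [CommRing 𝕜] {N : ℕ} {a : Fin N → 𝕜ˣ}

/-! ### The bare operators `A∂`, `E_j` and `Γ` -/

theorem E_eq_diagonal (a : Fin N → 𝕜ˣ) (j : Fin N) : E a j = Matrix.diagonal (Pi.single j 1) :=
  (Matrix.diagonal_single j 1).symm

theorem ADel_pow_mul_E (a : Fin N → 𝕜ˣ) (n : ℕ) (j : Fin N) :
    (ADel a : MatOp a) ^ n * E a j = Matrix.diagonal (Pi.single j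
      (MvPowerSeries.C (PsiDO.mono (MvPowerSeries.C ((a j : 𝕜) ^ n)) n))) := by
  rw [E_eq_diagonal]
  change Matrix.diagonal _ ^ n * _ = _
  rw [Matrix.diagonal_pow, Matrix.diagonal_mul_diagonal]
  congr 1
  funext u
  by_cases h : u = j
  · subst h
    rw [Pi.single_eq_same, Pi.single_eq_same, mul_one, Pi.pow_apply, ← map_pow,
      PsiDO.mono_pow (dx_const a _), map_pow, mul_one]
  · rw [Pi.single_eq_of_ne h, Pi.single_eq_of_ne h, mul_zero]

theorem timeDeriv_diagonal (j : Fin N) (i : ℕ) (f : Fin N → Op a) :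
    timeDeriv j i (Matrix.diagonal f) = Matrix.diagonal fun u => opTimeDeriv j i (f u) := by
  have h : (opTimeDeriv j i : Op a → Op a) 0 = 0 := map_zero (opTimeDerivHom j i)
  refine Eq.trans ?_ (Matrix.diagonal_map h)
  cases i <;> rfl

theorem opTimeDeriv_zero_C (j : Fin N) (P : PsiDO (dx a)) :
    opTimeDeriv j 0 (MvPowerSeries.C P : Op a)
      = MvPowerSeries.C (PsiDO.mapCoeff (MvPowerSeries.pderiv 𝕜 j) P) := by
  classical
  ext τ l
  rw [opTimeDeriv, coeff_opMap, MvPowerSeries.coeff_C, MvPowerSeries.coeff_C,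
    PsiDO.coeff_mapCoeff]
  split_ifs
  · rfl
  · simp

theorem opTimeDeriv_succ_C (j : Fin N) (i : ℕ) (P : PsiDO (dx a)) :
    opTimeDeriv j (i + 1) (MvPowerSeries.C P : Op a) = 0 := by
  classical
  ext τ : 1
  rw [opTimeDeriv, coeff_opDeriv, MvPowerSeries.coeff_C, if_neg, smul_zero]
  · rfl
  · intro h
    have := DFunLike.congr_fun h (j, i)
    simp at this

theorem opTimeDeriv_C_mono_const (j : Fin N) (i : ℕ) (c : 𝕜) (l : ℤ) :
    opTimeDeriv j i (MvPowerSeries.C (PsiDO.mono (MvPowerSeries.C c) l) : Op a) = 0 := by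
  cases i with
  | zero =>
    rw [opTimeDeriv_zero_C, PsiDO.mapCoeff_mono, MvPowerSeries.pderiv_C]
    have : (PsiDO.mono 0 l : PsiDO (dx a)) = 0 := by
      ext m
      simp [PsiDO.coeff_mono]
    rw [this, map_zero]
  | succ i => exact opTimeDeriv_succ_C j i _

theorem timeDeriv_ADel (j : Fin N) (i : ℕ) : timeDeriv j i (ADel a : MatOp a) = 0 := by
  change timeDeriv j i (Matrix.diagonal _) = 0
  rw [timeDeriv_diagonal]
  simp only [opTimeDeriv_C_mono_const]
  exact Matrix.diagonal_zero

theorem opTimeDeriv_one (j : Fin N) (i : ℕ) : opTimeDeriv j i (1 : Op a) = 0 :=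
  opTimeDeriv_C_mono_const j i 1 0

theorem timeDeriv_E (j : Fin N) (i : ℕ) (s : Fin N) : timeDeriv j i (E a s) = 0 := by
  rw [E_eq_diagonal, timeDeriv_diagonal, ← Matrix.diagonal_zero]
  congr 1
  funext u
  by_cases h : u = s
  · subst h
    rw [Pi.single_eq_same, opTimeDeriv_one]
  · rw [Pi.single_eq_of_ne h]
    exact map_zero (opTimeDerivHom j i)

theorem coeff_gamHigher_single (a : Fin N → 𝕜ˣ) (u : Fin N) (i : ℕ) :
    MvPowerSeries.coeff (Finsupp.single (u, i) 1) (gamHigher a u)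
      = PsiDO.mono (MvPowerSeries.C (((2 * i + 3 : ℕ) : 𝕜) * (a u : 𝕜) ^ (2 * i + 2)))
        (2 * i + 2) := by
  refine (finsum_eq_single _ i fun i' hi' => if_neg fun h => hi' ?_).trans (if_pos rfl)
  simpa [Finsupp.single_left_inj] using h.symm

theorem coeff_gamHigher_eq_zero {u : Fin N} {τ : Fin N × ℕ →₀ ℕ}
    (h : ∀ i, τ ≠ Finsupp.single (u, i) 1) : MvPowerSeries.coeff τ (gamHigher a u) = 0 := by
  refine Eq.trans (finsum_congr fun i => if_neg (h i)) finsum_zero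

theorem coeff_gamHigher_cases (a : Fin N → 𝕜ˣ) (u : Fin N) (τ : Fin N × ℕ →₀ ℕ) :
    (∃ i : ℕ, τ = Finsupp.single (u, i) 1) ∨ MvPowerSeries.coeff τ (gamHigher a u) = 0 := by
  by_cases h : ∃ i : ℕ, τ = Finsupp.single (u, i) 1
  · exact Or.inl h
  · exact Or.inr (coeff_gamHigher_eq_zero fun i hi => h ⟨i, hi⟩)

theorem commute_C_gamHigher (c : 𝕜) (l : ℤ) (u : Fin N) :
    Commute (MvPowerSeries.C (PsiDO.mono (MvPowerSeries.C c) l) : Op a) (gamHigher a u) := by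
  ext τ : 1
  rw [MvPowerSeries.coeff_C_mul, MvPowerSeries.coeff_mul_C]
  rcases coeff_gamHigher_cases a u τ with ⟨i, rfl⟩ | h
  · rw [coeff_gamHigher_single, PsiDO.mono_mul_mono _ (dx_const a _),
      PsiDO.mono_mul_mono _ (dx_const a _), mul_comm, add_comm l]
  · rw [h, mul_zero, zero_mul]

theorem opTimeDeriv_zero_gamHigher (j u : Fin N) : opTimeDeriv j 0 (gamHigher a u) = 0 := by
  ext τ l : 2
  rw [opTimeDeriv, coeff_opMap, PsiDO.coeff_mapCoeff]
  rcases coeff_gamHigher_cases a u τ with ⟨i, rfl⟩ | h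
  · rw [coeff_gamHigher_single, PsiDO.coeff_mono]
    split_ifs
    · rw [MvPowerSeries.pderiv_C]; rfl
    · rw [map_zero]; rfl
  · rw [h, PsiDO.coeff_zero, map_zero]; rfl

theorem opTimeDeriv_succ_gamHigher (j u : Fin N) (i : ℕ) :
    opTimeDeriv j (i + 1) (gamHigher a u) = if u = j then MvPowerSeries.C (PsiDO.mono
      (MvPowerSeries.C (((2 * i + 3 : ℕ) : 𝕜) * (a u : 𝕜) ^ (2 * i + 2))) (2 * i + 2)) else 0 := by
  classical
  ext τ : 1
  rw [opTimeDeriv, coeff_opDeriv]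
  by_cases h : τ = 0 ∧ u = j
  · obtain ⟨rfl, rfl⟩ := h
    rw [if_pos rfl, zero_add, coeff_gamHigher_single, MvPowerSeries.coeff_C, if_pos rfl]
    simp
  · rw [coeff_gamHigher_eq_zero, smul_zero]
    · split_ifs with hu
      · rw [MvPowerSeries.coeff_C, if_neg fun hτ => h ⟨hτ, hu⟩]
      · simp
    -- If raising τ at (j, i) gives a single variable (u, i'), that variable is (j, i) and τ = 0,
    -- the case already excluded.
    · intro i' hi'
      have hle : Finsupp.single (j, i) 1 ≤ Finsupp.single (u, i') 1 := hi' ▸ le_add_self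
      rw [Finsupp.single_le_iff, Finsupp.single_apply] at hle
      split_ifs at hle with hij
      · rw [Prod.mk.injEq] at hij
        obtain ⟨rfl, rfl⟩ := hij
        exact h ⟨by simpa using hi', rfl⟩
      · omega

theorem timeDeriv_Gam (j : Fin N) (i : ℕ) :
    timeDeriv j i (Gam a) = Matrix.diagonal (Pi.single j (MvPowerSeries.C (PsiDO.mono
      (MvPowerSeries.C (((2 * i + 1 : ℕ) : 𝕜) * (a j : 𝕜) ^ (2 * i))) (2 * i)))) := by
  rw [Gam, timeDeriv_diagonal]
  congr 1
  funext u
  rw [opTimeDeriv_add]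
  cases i with
  | zero =>
    rw [opTimeDeriv_zero_gamHigher, add_zero, opTimeDeriv_zero_C, PsiDO.mapCoeff_mono]
    by_cases h : u = j
    · subst h
      rw [Pi.single_eq_same, MvPowerSeries.pderiv_X_self]
      simp
    · rw [Pi.single_eq_of_ne h, MvPowerSeries.pderiv_X_of_ne h]
      have : (PsiDO.mono 0 0 : PsiDO (dx a)) = 0 := by
        ext m
        simp [PsiDO.coeff_mono]
      rw [this, map_zero]
  | succ i =>
    rw [opTimeDeriv_succ_C, zero_add, opTimeDeriv_succ_gamHigher]
    by_cases h : u = j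
    · subst h
      rw [if_pos rfl, Pi.single_eq_same]
      push_cast
      ring_nf
    · rw [if_neg h, Pi.single_eq_of_ne h]

/-- Only t_1^j fails to commute with ∂, so the commutator on the right sees a single term of Γ, and
[∂^n, t_1^j] = n a_j⁻¹ ∂^(n-1) reproduces the coefficient of t_n^j in Γ. The explicit time
dependence of Γ is designed for this. -/
theorem commutator_Gam (j : Fin N) (i : ℕ) :
    timeDeriv j i (Gam a) = (ADel a : MatOp a) ^ (2 * i + 1) * E a j * Gam a
      - Gam a * ((ADel a : MatOp a) ^ (2 * i + 1) * E a j) := by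
  rw [timeDeriv_Gam, ADel_pow_mul_E, Gam, Matrix.diagonal_mul_diagonal,
    Matrix.diagonal_mul_diagonal, Matrix.diagonal_sub]
  congr 1
  funext u
  by_cases h : u = j
  · subst h
    rw [Pi.single_eq_same, Pi.single_eq_same, mul_add, add_mul, (commute_C_gamHigher _ _ u).eq,
      add_sub_add_right_eq_sub, ← map_mul, ← map_mul, ← map_sub,
      PsiDO.mono_commutator (dx_const a _) (by rw [dx_X, dx_const]), dx_X, ← map_mul]
    have : (a u : 𝕜) ^ (2 * i + 1) * ((a u)⁻¹ : 𝕜ˣ).val = (a u : 𝕜) ^ (2 * i) := by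
      rw [pow_succ, mul_assoc, Units.mul_inv, mul_one]
    rw [this, ← map_zsmul, zsmul_eq_mul]
    push_cast
    ring_nf
  · rw [Pi.single_eq_of_ne h, Pi.single_eq_of_ne h, zero_mul, mul_zero, sub_zero]

theorem commute_ADel_E (j : Fin N) : Commute (ADel a : MatOp a) (E a j) := by
  rw [E_eq_diagonal]
  change Matrix.diagonal _ * Matrix.diagonal _ = Matrix.diagonal _ * Matrix.diagonal _
  rw [Matrix.diagonal_mul_diagonal, Matrix.diagonal_mul_diagonal]
  congr 1
  funext u
  by_cases h : u = j
  · subst h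
    rw [Pi.single_eq_same, mul_one, one_mul]
  · rw [Pi.single_eq_of_ne h, mul_zero, zero_mul]

theorem commute_E_E (s j : Fin N) : Commute (E a s) (E a j) := by
  rw [E_eq_diagonal, E_eq_diagonal]
  change Matrix.diagonal _ * Matrix.diagonal _ = Matrix.diagonal _ * Matrix.diagonal _
  rw [Matrix.diagonal_mul_diagonal, Matrix.diagonal_mul_diagonal]
  congr 1
  funext u
  by_cases h : u = j
  · subst h
    rw [Pi.single_eq_same, mul_one, one_mul]
  · rw [Pi.single_eq_of_ne h, mul_zero, zero_mul]

/-! ### Time evolution of the operators `B_{prs}` -/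

/-- The dressed operator `L^n R_j` with `n = 2i+1`. -/
def laxR (Φ : (MatOp a)ˣ) (j : Fin N) (i : ℕ) : MatOp a :=
  Φ * ((ADel a : MatOp a) ^ (2 * i + 1) * E a j) * (Φ⁻¹ : (MatOp a)ˣ)

theorem IsDressing.timeDeriv {Φ : (MatOp a)ˣ} (hΦ : IsDressing Φ) (j : Fin N) (i : ℕ) :
    timeDeriv j i (Φ : MatOp a) = -negPart (laxR Φ j i) * Φ := by
  rw [hΦ.sato, satoField_eq, laxR]

theorem IsDressing.timeDeriv_addB {Φ : (MatOp a)ˣ} (hΦ : IsDressing Φ) (j : Fin N) (i : ℕ)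
    (p r : ℕ) (s : Fin N) :
    BKP.timeDeriv j i (addB Φ p r s) = (laxR Φ j i - negPart (laxR Φ j i)) * addB Φ p r s
      - addB Φ p r s * (laxR Φ j i - negPart (laxR Φ j i)) := by
  have key : ∀ K : MatOp a, BKP.timeDeriv j i K = (ADel a : MatOp a) ^ (2 * i + 1) * E a j * K
      - K * ((ADel a : MatOp a) ^ (2 * i + 1) * E a j) →
      Φ * K * (Φ⁻¹ : (MatOp a)ˣ) ∈ innerSubring (timeDerivHom j i) (timeDeriv_mul j i)
        (laxR Φ j i - negPart (laxR Φ j i)) := fun K hK =>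
    conj_mem_innerSubring (D := timeDerivHom j i) (hD := timeDeriv_mul j i)
      (V := negPart (laxR Φ j i)) (hΦ.timeDeriv j i) hK
  have hM : orlov Φ ∈ innerSubring (timeDerivHom j i) (timeDeriv_mul j i)
      (laxR Φ j i - negPart (laxR Φ j i)) := key _ (commutator_Gam j i)
  have hL : (lax Φ : MatOp a) ∈ innerSubring (timeDerivHom j i) (timeDeriv_mul j i)
      (laxR Φ j i - negPart (laxR Φ j i)) := key _ <| by
    rw [timeDeriv_ADel, eq_comm, sub_eq_zero]
    exact ((Commute.refl _).pow_left _).mul_left (commute_ADel_E j).symm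
  have hR : projR Φ s ∈ innerSubring (timeDerivHom j i) (timeDeriv_mul j i)
      (laxR Φ j i - negPart (laxR Φ j i)) := key _ <| by
    rw [timeDeriv_E, eq_comm, sub_eq_zero]
    exact ((commute_ADel_E s).pow_left _).mul_left (commute_E_E j s)
  have hB : addB Φ p r s ∈ innerSubring (timeDerivHom j i) (timeDeriv_mul j i)
      (laxR Φ j i - negPart (laxR Φ j i)) :=
    sub_mem (mul_mem (mul_mem (pow_mem hM p) (pow_mem hL r)) hR)
      (mul_mem (mul_mem (mul_mem (mul_mem (pow_mem (neg_mem (one_mem _)) r) hR)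
        (zpow_mem_innerSubring hL _)) (pow_mem hM p)) hL)
  exact hB

/-- The negative part of `B_{prs}` evolves autonomously. -/
theorem IsDressing.timeDeriv_negPart_addB {Φ : (MatOp a)ˣ} (hΦ : IsDressing Φ) (j : Fin N)
    (i : ℕ) (p r : ℕ) (s : Fin N) :
    BKP.timeDeriv j i (negPart (addB Φ p r s))
      = negPart ((laxR Φ j i - negPart (laxR Φ j i)) * negPart (addB Φ p r s)
        - negPart (addB Φ p r s) * (laxR Φ j i - negPart (laxR Φ j i))) := by
  rw [timeDeriv_negPart, hΦ.timeDeriv_addB, negPart_commutator_negPart]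
  rw [negPart_sub, negPart_negPart, sub_self]

/-- Under Φ ↦ Φ - εXΦ a dressed operator C varies by [C, X]; the two terms are the variations of the
right factor Φ and of C_- in -C_- Φ. -/
theorem satoVariation_eq (Φ : (MatOp a)ˣ) (X : MatOp a) (j : Fin N) (i : ℕ) :
    satoVariation Φ (-X * Φ) j i = negPart (laxR Φ j i) * X * Φ
      - negPart (laxR Φ j i * X - X * laxR Φ j i) * Φ := by
  have h : (TrivSqZeroExt.inl (ADel a : MatOp a) : DualNumber (MatOp a)) ^ (2 * i + 1)
      * TrivSqZeroExt.inl (E a j)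
      = TrivSqZeroExt.inl ((ADel a : MatOp a) ^ (2 * i + 1) * E a j) := by
    rw [TrivSqZeroExt.inl_mul, TrivSqZeroExt.inl_pow]
  rw [satoVariation, satoField_eq, h, laxR]
  generalize (ADel a : MatOp a) ^ (2 * i + 1) * E a j = C
  have hp : (perturb Φ (-X * Φ) : DualNumber (MatOp a))
      = TrivSqZeroExt.inl (Φ : MatOp a) + TrivSqZeroExt.inr (-X * Φ) := rfl
  have hi : (((perturb Φ (-X * Φ))⁻¹ : (DualNumber (MatOp a))ˣ) : DualNumber (MatOp a))
      = TrivSqZeroExt.inl ((Φ⁻¹ : (MatOp a)ˣ) : MatOp a)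
        - TrivSqZeroExt.inr ((Φ⁻¹ : (MatOp a)ˣ) * (-X * Φ) * (Φ⁻¹ : (MatOp a)ˣ)) := rfl
  rw [hp, hi, negPartDual]
  simp only [TrivSqZeroExt.snd_mul, TrivSqZeroExt.fst_mul, TrivSqZeroExt.fst_add,
    TrivSqZeroExt.snd_add, TrivSqZeroExt.fst_sub, TrivSqZeroExt.snd_sub, TrivSqZeroExt.fst_neg,
    TrivSqZeroExt.snd_neg, TrivSqZeroExt.fst_inl, TrivSqZeroExt.snd_inl, TrivSqZeroExt.fst_inr,
    TrivSqZeroExt.snd_inr, add_zero, zero_add, sub_zero, zero_sub, mul_zero, smul_eq_mul,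
    MulOpposite.smul_eq_mul_unop, MulOpposite.unop_op]
  have h2 : Φ * C * -(((Φ⁻¹ : (MatOp a)ˣ) : MatOp a) * (-X * Φ) * ((Φ⁻¹ : (MatOp a)ˣ) : MatOp a))
      + -X * Φ * C * ((Φ⁻¹ : (MatOp a)ˣ) : MatOp a)
      = Φ * C * ((Φ⁻¹ : (MatOp a)ˣ) : MatOp a) * X
        - X * (Φ * C * ((Φ⁻¹ : (MatOp a)ˣ) : MatOp a)) := by
    simp only [neg_mul, mul_neg, neg_neg, mul_assoc, Units.mul_inv, mul_one, sub_eq_add_neg]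
  rw [h2]
  simp only [neg_mul, mul_neg, neg_neg, mul_assoc, sub_eq_add_neg]

/-- Substituting the evolution of X leaves [C_-, X] - [C_-, X]_-, which is zero because products of
negative operators are negative. -/
theorem flowCommutator_eq_zero {Φ : (MatOp a)ˣ} (hΦ : IsDressing Φ) {X : MatOp a}
    (hX : negPart X = X) (j : Fin N) (i : ℕ)
    (h : timeDeriv j i X = negPart ((laxR Φ j i - negPart (laxR Φ j i)) * X
        - X * (laxR Φ j i - negPart (laxR Φ j i)))) :
    flowCommutator Φ (-X * Φ) j i = 0 := by
  rw [flowCommutator, satoVariation_eq, neg_mul, timeDeriv_neg, timeDeriv_mul, h, hΦ.timeDeriv]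
  generalize laxR Φ j i = C
  have h1 := negPart_mul_of_neg (negPart_negPart C) hX
  have h2 := negPart_mul_of_neg hX (negPart_negPart C)
  simp only [sub_mul, mul_sub, negPart_sub, h1, h2, neg_mul, mul_neg, ← mul_assoc]
  abel

end Operators

/-! ### Coefficientwise convergence and its compatibility with the operations -/

section Convergence

variable {𝕜 : Type*} [CommRing 𝕜] [TopologicalSpace 𝕜] [IsTopologicalRing 𝕜] {N : ℕ}
  {a : Fin N → 𝕜ˣ} {ι : Type*} {c : ι → 𝕜}

open scoped MvPowerSeries.WithPiTopology

/-- The series `∑ c_x P_x` of pseudo-differential operators converges coefficientwise to `Q`. -/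
def PsiDO.HasSumCoeff (c : ι → 𝕜) (P : ι → PsiDO (dx a)) (Q : PsiDO (dx a)) : Prop :=
  ∀ l : ℤ, HasSum (fun x => c x • (P x).coeff l) (Q.coeff l)

theorem hasSum_pderiv (j : Fin N) {f : ι → Fn 𝕜 N} {g : Fn 𝕜 N}
    (h : HasSum (fun x => c x • f x) g) :
    HasSum (fun x => c x • MvPowerSeries.pderiv 𝕜 j (f x)) (MvPowerSeries.pderiv 𝕜 j g) := by
  rw [MvPowerSeries.WithPiTopology.hasSum_iff_hasSum_coeff] at h ⊢
  intro β
  simpa only [MvPowerSeries.coeff_smul, MvPowerSeries.coeff_pderiv, mul_assoc] using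
    (h (β + Finsupp.single j 1)).mul_right _

theorem hasSum_const_smul (b : 𝕜) {f : ι → Fn 𝕜 N} {g : Fn 𝕜 N}
    (h : HasSum (fun x => c x • f x) g) : HasSum (fun x => c x • (b • f x)) (b • g) := by
  simpa only [MvPowerSeries.smul_eq_C_mul, mul_left_comm] using h.mul_left (MvPowerSeries.C b)

theorem hasSum_dx {f : ι → Fn 𝕜 N} {g : Fn 𝕜 N} (h : HasSum (fun x => c x • f x) g) :
    HasSum (fun x => c x • dx a (f x)) (dx a g) := by
  simp only [dx_apply, Finset.smul_sum]
  exact hasSum_sum fun j _ => hasSum_const_smul _ (hasSum_pderiv j h)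

theorem hasSum_iterate_dx (r : ℕ) {f : ι → Fn 𝕜 N} {g : Fn 𝕜 N}
    (h : HasSum (fun x => c x • f x) g) :
    HasSum (fun x => c x • (dx a)^[r] (f x)) ((dx a)^[r] g) := by
  induction r with
  | zero => exact h
  | succ r ih =>
    simp only [Function.iterate_succ_apply']
    exact hasSum_dx ih

namespace PsiDO.HasSumCoeff

variable {P P' : ι → PsiDO (dx a)} {Q Q' : PsiDO (dx a)}

theorem sub (h : HasSumCoeff c P Q) (h' : HasSumCoeff c P' Q') :
    HasSumCoeff c (fun x => P x - P' x) (Q - Q') := fun l => by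
  simpa only [coeff_sub, smul_sub] using (h l).sub (h' l)

theorem sum {κ : Type*} {s : Finset κ} {P : κ → ι → PsiDO (dx a)} {Q : κ → PsiDO (dx a)}
    (h : ∀ i ∈ s, HasSumCoeff c (P i) (Q i)) :
    HasSumCoeff c (fun x => ∑ i ∈ s, P i x) (∑ i ∈ s, Q i) := fun l => by
  simpa only [coeff_sum, Finset.smul_sum] using hasSum_sum fun i hi => h i hi l

theorem nsmul (n : ℕ) (h : HasSumCoeff c P Q) : HasSumCoeff c (fun x => n • P x) (n • Q) := by
  simpa using sum (s := Finset.range n) fun _ _ => h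

omit [IsTopologicalRing 𝕜] in
theorem negPart (h : HasSumCoeff c P Q) :
    HasSumCoeff c (fun x => (P x).negPart) Q.negPart := fun l => by
  simp only [coeff_negPart]
  split_ifs
  · exact h l
  · simp

theorem mapCoeff_pderiv (j : Fin N) (h : HasSumCoeff c P Q) :
    HasSumCoeff c (fun x => mapCoeff (MvPowerSeries.pderiv 𝕜 j) (P x))
      (mapCoeff (MvPowerSeries.pderiv 𝕜 j) Q) := fun l => hasSum_pderiv j (h l)

/-- The common order bound b makes each coefficient of the product a finite sum over an index set
independent of x, so no interchange of infinite sums arises. -/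
theorem mul_left {b : ℤ} (hP : ∀ x l, b < l → (P x).coeff l = 0)
    (hQ : ∀ l, b < l → Q.coeff l = 0) (h : HasSumCoeff c P Q) (W : PsiDO (dx a)) :
    HasSumCoeff c (fun x => W * P x) (W * Q) := fun l => by
  obtain ⟨e, he⟩ := W.bounded
  by_cases hl : e + b < l
  · simpa only [coeff_mul, mulCoeff_eq_zero he (hP _) l hl, mulCoeff_eq_zero he hQ l hl,
      smul_zero] using hasSum_zero
  · obtain ⟨n, rfl⟩ : ∃ n : ℕ, l = e + b - n := ⟨(e + b - l).toNat, by omega⟩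
    simp only [coeff_mul, mulCoeff_eq_star he (hP _), mulCoeff_eq_star he hQ, star,
      Finset.smul_sum]
    refine hasSum_sum fun x _ => hasSum_sum fun y _ => ?_
    simp only [zsmul_eq_mul, ← mul_assoc, ← mul_smul_comm]
    exact (hasSum_iterate_dx _ (h _)).mul_left _

theorem mul_right {b : ℤ} (hP : ∀ x l, b < l → (P x).coeff l = 0)
    (hQ : ∀ l, b < l → Q.coeff l = 0) (h : HasSumCoeff c P Q) (W : PsiDO (dx a)) :
    HasSumCoeff c (fun x => P x * W) (Q * W) := fun l => by
  obtain ⟨e, he⟩ := W.bounded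
  by_cases hl : b + e < l
  · simpa only [coeff_mul, mulCoeff_eq_zero (hP _) he l hl, mulCoeff_eq_zero hQ he l hl,
      smul_zero] using hasSum_zero
  · obtain ⟨n, rfl⟩ : ∃ n : ℕ, l = b + e - n := ⟨(b + e - l).toNat, by omega⟩
    simp only [coeff_mul, mulCoeff_eq_star (hP _) he, mulCoeff_eq_star hQ he, star,
      Finset.smul_sum]
    refine hasSum_sum fun x _ => hasSum_sum fun y _ => ?_
    simp only [← mul_smul_comm (_ : ℤ), ← smul_mul_assoc (c _)]
    exact (h _).mul_right _

omit [IsTopologicalRing 𝕜] in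
theorem unique [T2Space 𝕜] (h : HasSumCoeff c P Q) (h' : HasSumCoeff c P Q') : Q = Q' := by
  ext l : 1
  exact (h l).unique (h' l)

end PsiDO.HasSumCoeff

/-- The series `∑ c_x Y_x` of matrix operators converges coefficientwise to `X`. -/
def HasSumCoeff (c : ι → 𝕜) (Y : ι → MatOp a) (X : MatOp a) : Prop :=
  ∀ (u v : Fin N) (τ : Fin N × ℕ →₀ ℕ),
    PsiDO.HasSumCoeff c (fun x => MvPowerSeries.coeff τ (Y x u v)) (MvPowerSeries.coeff τ (X u v))

omit [IsTopologicalRing 𝕜] in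
theorem hasSumCoeff_iff {Y : ι → MatOp a} {X : MatOp a} :
    HasSumCoeff c Y X ↔ ∀ (u v : Fin N) (τ : Fin N × ℕ →₀ ℕ) (l : ℤ) (β : Fin N →₀ ℕ),
      HasSum (fun x => c x * entryCoeff (Y x) u v τ l β) (entryCoeff X u v τ l β) :=
  forall_congr' fun _ => forall_congr' fun _ => forall_congr' fun _ => forall_congr' fun _ =>
    MvPowerSeries.WithPiTopology.hasSum_iff_hasSum_coeff

namespace HasSumCoeff

variable {Y Y' : ι → MatOp a} {X X' : MatOp a}

omit [IsTopologicalRing 𝕜] in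
theorem unique [T2Space 𝕜] (h : HasSumCoeff c Y X) (h' : HasSumCoeff c Y X') : X = X' := by
  ext u v τ : 2
  exact (h u v τ).unique (h' u v τ)

theorem sub (h : HasSumCoeff c Y X) (h' : HasSumCoeff c Y' X') :
    HasSumCoeff c (fun x => Y x - Y' x) (X - X') := fun u v τ => (h u v τ).sub (h' u v τ)

omit [IsTopologicalRing 𝕜] in
theorem negPart (h : HasSumCoeff c Y X) :
    HasSumCoeff c (fun x => BKP.negPart (Y x)) (BKP.negPart X) := fun u v τ => (h u v τ).negPart

theorem timeDeriv (h : HasSumCoeff c Y X) (j : Fin N) (i : ℕ) :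
    HasSumCoeff c (fun x => BKP.timeDeriv j i (Y x)) (BKP.timeDeriv j i X) := fun u v τ => by
  simp only [timeDeriv_apply]
  cases i with
  | zero => exact (h u v τ).mapCoeff_pderiv j
  | succ i => exact (h u v _).nsmul _

omit [TopologicalSpace 𝕜] [IsTopologicalRing 𝕜] in
theorem coeff_eq_zero {W : MatOp a} (hW : BKP.negPart W = W) (u v : Fin N)
    (τ : Fin N × ℕ →₀ ℕ) : ∀ l, -1 < l → (MvPowerSeries.coeff τ (W u v)).coeff l = 0 := by
  rw [← PsiDO.negPart_eq_self_iff, ← coeff_negPart, hW]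

theorem mul_left (hY : ∀ x, BKP.negPart (Y x) = Y x) (hX : BKP.negPart X = X)
    (h : HasSumCoeff c Y X) (W : MatOp a) : HasSumCoeff c (fun x => W * Y x) (W * X) := by
  intro u v τ
  simp only [coeff_matMul]
  exact .sum fun w _ => .sum fun y _ => (h w v y.2).mul_left
    (fun x => coeff_eq_zero (hY x) w v y.2) (coeff_eq_zero hX w v y.2) _

theorem mul_right (hY : ∀ x, BKP.negPart (Y x) = Y x) (hX : BKP.negPart X = X)
    (h : HasSumCoeff c Y X) (W : MatOp a) : HasSumCoeff c (fun x => Y x * W) (X * W) := by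
  intro u v τ
  simp only [coeff_matMul]
  exact .sum fun w _ => .sum fun y _ => (h u w y.1).mul_right
    (fun x => coeff_eq_zero (hY x) u w y.1) (coeff_eq_zero hX u w y.1) _

end HasSumCoeff

/-- The additional flows commute with the flows of the hierarchy. -/
theorem IsNegPartD.flowCommutator_eq_zero [Algebra ℚ 𝕜] [T2Space 𝕜] {logq : 𝕜} {Φ : (MatOp a)ˣ}
    (hΦ : IsDressing Φ) {l k : ℕ} {s : Fin N} {X : MatOp a} (hX : IsNegPartD logq Φ l k s X)
    (j : Fin N) (i : ℕ) : flowCommutator Φ (-X * Φ) j i = 0 := by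
  have hX := hasSumCoeff_iff.2 hX
  -- Applying the negative part to the convergent series leaves its terms unchanged, so uniqueness
  -- of sums gives the claim.
  have hneg : negPart X = X := by
    have h := hX.negPart
    simp only [negPart_negPart] at h
    exact h.unique hX
  -- The termwise differentiated series has ∂X/∂t as its sum; summing the evolution equations of the
  -- B_- gives a second value, and the two agree in a Hausdorff ring.
  refine BKP.flowCommutator_eq_zero hΦ hneg j i ((hX.timeDeriv j i).unique ?_)
  simp only [hΦ.timeDeriv_negPart_addB]
  exact ((hX.mul_left (fun _ => negPart_negPart _) hneg _).sub
    (hX.mul_right (fun _ => negPart_negPart _) hneg _)).negPart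

end Convergence

/-! ### The weight filtration and the vanishing of low-weight coefficients -/

section Filtration

variable {𝕜 : Type*} [CommRing 𝕜] {N : ℕ} {a : Fin N → 𝕜ˣ}

/-- Power series without terms of total degree less than `n`. -/
def fnFil (𝕜 : Type*) [CommRing 𝕜] (N : ℕ) (n : ℤ) : AddSubgroup (Fn 𝕜 N) where
  carrier := {f | ∀ β : Fin N →₀ ℕ, (β.degree : ℤ) < n → MvPowerSeries.coeff β f = 0}
  zero_mem' _ _ := map_zero _
  add_mem' hf hg β hβ := by rw [map_add, hf β hβ, hg β hβ, add_zero]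
  neg_mem' hf β hβ := by rw [map_neg, hf β hβ, neg_zero]

theorem mem_fnFil_of_nonpos {n : ℤ} (hn : n ≤ 0) (f : Fn 𝕜 N) : f ∈ fnFil 𝕜 N n :=
  fun _ hβ => absurd hβ (by omega)

theorem X_mem_fnFil (j : Fin N) : (MvPowerSeries.X j : Fn 𝕜 N) ∈ fnFil 𝕜 N 1 := by
  classical
  intro β hβ
  rw [MvPowerSeries.coeff_X, if_neg]
  rintro rfl
  simp at hβ

theorem mul_mem_fnFil {m n : ℤ} {f g : Fn 𝕜 N} (hf : f ∈ fnFil 𝕜 N m) (hg : g ∈ fnFil 𝕜 N n) :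
    f * g ∈ fnFil 𝕜 N (m + n) := by
  classical
  intro β hβ
  rw [MvPowerSeries.coeff_mul]
  refine Finset.sum_eq_zero fun x hx => ?_
  rw [Finset.HasAntidiagonal.mem_antidiagonal] at hx
  have hdeg : β.degree = x.1.degree + x.2.degree := by rw [← hx, map_add]
  by_cases h : (x.1.degree : ℤ) < m
  · rw [hf _ h, zero_mul]
  · rw [hg _ (by omega), mul_zero]

theorem smul_mem_fnFil {n : ℤ} (b : 𝕜) {f : Fn 𝕜 N} (hf : f ∈ fnFil 𝕜 N n) :
    b • f ∈ fnFil 𝕜 N n := fun β hβ => by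
  rw [MvPowerSeries.coeff_smul, hf β hβ, mul_zero]

theorem dx_mem_fnFil {n : ℤ} {f : Fn 𝕜 N} (hf : f ∈ fnFil 𝕜 N n) :
    dx a f ∈ fnFil 𝕜 N (n - 1) := by
  rw [dx_apply]
  refine sum_mem fun j _ => smul_mem_fnFil _ fun β hβ => ?_
  rw [MvPowerSeries.coeff_pderiv, hf, zero_mul]
  rw [map_add, Finsupp.degree_single]
  push_cast
  omega

theorem iterate_dx_mem_fnFil {n : ℤ} {f : Fn 𝕜 N} (hf : f ∈ fnFil 𝕜 N n) (r : ℕ) :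
    (dx a)^[r] f ∈ fnFil 𝕜 N (n - r) := by
  induction r with
  | zero => simpa using hf
  | succ r ih =>
    rw [Function.iterate_succ_apply', Nat.cast_succ, ← sub_sub]
    exact dx_mem_fnFil ih

/-- Pseudo-differential operators without terms of weight less than `n`, where `t_1^j` has weight
`1` and `∂` has weight `-1`. -/
def psiFil (a : Fin N → 𝕜ˣ) (n : ℤ) : AddSubgroup (PsiDO (dx a)) where
  carrier := {P | ∀ l, P.coeff l ∈ fnFil 𝕜 N (n + l)}
  zero_mem' _ := zero_mem _
  add_mem' hP hQ l := add_mem (hP l) (hQ l)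
  neg_mem' hP l := neg_mem (hP l)

theorem mono_mem_psiFil {n l : ℤ} {f : Fn 𝕜 N} (hf : f ∈ fnFil 𝕜 N (n + l)) :
    PsiDO.mono f l ∈ psiFil a n := fun m => by
  rw [PsiDO.coeff_mono]
  split_ifs with h
  · rwa [h]
  · exact zero_mem _

theorem mem_psiFil_of_nonpos {n : ℤ} (hn : n ≤ 0) {P : PsiDO (dx a)}
    (hP : ∀ l, 0 < l → P.coeff l = 0) : P ∈ psiFil a n := fun l => by
  by_cases hl : 0 < l
  · rw [hP l hl]
    exact zero_mem _
  · exact mem_fnFil_of_nonpos (by omega) _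

/-- Each term b d^r(c) ∂^(i+j-r) keeps the total weight: d^r lowers the degree bound by r, and the
order also drops by r. -/
theorem mul_mem_psiFil {m n : ℤ} {P Q : PsiDO (dx a)} (hP : P ∈ psiFil a m)
    (hQ : Q ∈ psiFil a n) : P * Q ∈ psiFil a (m + n) := fun l => by
  rw [PsiDO.coeff_mul, PsiDO.mulCoeff]
  refine finsum_induction (· ∈ fnFil 𝕜 N (m + n + l)) (zero_mem _) (fun _ _ => add_mem)
    fun x => zsmul_mem ?_ _
  have h := mul_mem_fnFil (hP x.1) (iterate_dx_mem_fnFil (a := a) (hQ (l - x.1 + x.2)) x.2)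
  rwa [show m + x.1 + (n + (l - x.1 + x.2) - x.2) = m + n + l by ring] at h

/-- The weight of a monomial in the higher times, `t_n^j` having weight `n`. -/
def timeWeight (N : ℕ) : (Fin N × ℕ →₀ ℕ) →+ ℕ := Finsupp.weight fun p => 2 * p.2 + 3

/-- Scalar operators without terms of weight less than `n`. -/
def opFil (a : Fin N → 𝕜ˣ) (n : ℤ) : AddSubgroup (Op a) where
  carrier := {w | ∀ τ, MvPowerSeries.coeff τ w ∈ psiFil a (n - timeWeight N τ)}
  zero_mem' _ := zero_mem _
  add_mem' hv hw τ := add_mem (hv τ) (hw τ)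
  neg_mem' hv τ := neg_mem (hv τ)

theorem mul_mem_opFil {m n : ℤ} {v w : Op a} (hv : v ∈ opFil a m) (hw : w ∈ opFil a n) :
    v * w ∈ opFil a (m + n) := fun τ => by
  classical
  rw [MvPowerSeries.coeff_mul]
  refine sum_mem fun x hx => ?_
  rw [Finset.HasAntidiagonal.mem_antidiagonal] at hx
  have h := mul_mem_psiFil (hv x.1) (hw x.2)
  have hτ : timeWeight N τ = timeWeight N x.1 + timeWeight N x.2 := by rw [← hx, map_add]
  rwa [sub_add_sub_comm, ← Nat.cast_add, ← hτ] at h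

theorem C_mem_opFil {n : ℤ} {P : PsiDO (dx a)} (hP : P ∈ psiFil a n) :
    (MvPowerSeries.C P : Op a) ∈ opFil a n := fun τ => by
  classical
  rw [MvPowerSeries.coeff_C]
  split_ifs with h
  · rwa [h, map_zero, Nat.cast_zero, sub_zero]
  · exact zero_mem _

theorem C_mono_mem_opFil {n l : ℤ} (h : n + l ≤ 0) (f : Fn 𝕜 N) :
    (MvPowerSeries.C (PsiDO.mono f l) : Op a) ∈ opFil a n :=
  C_mem_opFil (mono_mem_psiFil (mem_fnFil_of_nonpos h f))

/-- Every term t_n^j ∂^(n-1) has weight n - (n - 1) = 1. -/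
theorem gamHigher_mem_opFil (u : Fin N) : gamHigher a u ∈ opFil a 1 := fun τ => by
  rcases coeff_gamHigher_cases a u τ with ⟨i, rfl⟩ | h
  · rw [coeff_gamHigher_single]
    refine mono_mem_psiFil (mem_fnFil_of_nonpos ?_ _)
    rw [timeWeight, Finsupp.weight_single]
    simp only [smul_eq_mul, one_mul]
    push_cast
    omega
  · rw [h]
    exact zero_mem _

/-- Matrix operators without terms of weight less than `n`. -/
def matFil (a : Fin N → 𝕜ˣ) (n : ℤ) : AddSubgroup (MatOp a) where
  carrier := {W | ∀ u v, W u v ∈ opFil a n}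
  zero_mem' _ _ := zero_mem _
  add_mem' hV hW u v := add_mem (hV u v) (hW u v)
  neg_mem' hV u v := neg_mem (hV u v)

theorem mul_mem_matFil {m n : ℤ} {V W : MatOp a} (hV : V ∈ matFil a m) (hW : W ∈ matFil a n) :
    V * W ∈ matFil a (m + n) := fun u v => by
  rw [Matrix.mul_apply]
  exact sum_mem fun w _ => mul_mem_opFil (hV u w) (hW w v)

theorem diagonal_mem_matFil {n : ℤ} {f : Fin N → Op a} (hf : ∀ u, f u ∈ opFil a n) :
    Matrix.diagonal f ∈ matFil a n := fun u v => by
  rw [Matrix.diagonal_apply]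
  split_ifs
  · exact hf u
  · exact zero_mem _

theorem one_mem_matFil : (1 : MatOp a) ∈ matFil a 0 := by
  rw [← Matrix.diagonal_one]
  exact diagonal_mem_matFil fun _ => C_mono_mem_opFil (zero_add 0).le 1

theorem pow_mem_matFil {n : ℤ} {W : MatOp a} (hW : W ∈ matFil a n) (p : ℕ) :
    W ^ p ∈ matFil a (p * n) := by
  induction p with
  | zero => simpa using one_mem_matFil
  | succ p ih =>
    rw [pow_succ, Nat.cast_succ, add_mul, one_mul]
    exact mul_mem_matFil ih hW

theorem zpow_mem_matFil {n : ℤ} {U : (MatOp a)ˣ} (hU : (U : MatOp a) ∈ matFil a n)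
    (hU' : ((U⁻¹ : (MatOp a)ˣ) : MatOp a) ∈ matFil a (-n)) (r : ℤ) :
    ((U ^ r : (MatOp a)ˣ) : MatOp a) ∈ matFil a (r * n) := by
  induction r with
  | zero => simpa using one_mem_matFil
  | succ r ih =>
    rw [zpow_add_one, Units.val_mul, add_mul, one_mul]
    exact mul_mem_matFil ih hU
  | pred r ih =>
    rw [zpow_sub_one, Units.val_mul, sub_mul, one_mul, sub_eq_add_neg]
    exact mul_mem_matFil ih hU'

theorem ADel_mem_matFil : (ADel a : MatOp a) ∈ matFil a (-1) :=
  diagonal_mem_matFil fun _ => C_mono_mem_opFil (by norm_num) _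

theorem ADel_inv_mem_matFil : (((ADel a)⁻¹ : (MatOp a)ˣ) : MatOp a) ∈ matFil a 1 :=
  diagonal_mem_matFil fun _ => C_mono_mem_opFil (by norm_num) _

theorem delMat_mem_matFil : (delMat a : MatOp a) ∈ matFil a (-1) :=
  diagonal_mem_matFil fun _ => C_mono_mem_opFil (by norm_num) _

theorem delMat_inv_mem_matFil : (((delMat a)⁻¹ : (MatOp a)ˣ) : MatOp a) ∈ matFil a 1 :=
  diagonal_mem_matFil fun _ => C_mono_mem_opFil (by norm_num) _

theorem E_mem_matFil (s : Fin N) : E a s ∈ matFil a 0 := by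
  rw [E_eq_diagonal]
  refine diagonal_mem_matFil fun u => ?_
  by_cases h : u = s
  · subst h
    rw [Pi.single_eq_same]
    exact C_mono_mem_opFil (zero_add 0).le 1
  · rw [Pi.single_eq_of_ne h]
    exact zero_mem _

theorem Gam_mem_matFil : Gam a ∈ matFil a 1 :=
  diagonal_mem_matFil fun u => add_mem (C_mem_opFil (mono_mem_psiFil (X_mem_fnFil u)))
    (gamHigher_mem_opFil u)

theorem IsDressing.coeff_eq_zero {Φ : (MatOp a)ˣ} (hΦ : IsDressing Φ) (u v : Fin N)
    (τ : Fin N × ℕ →₀ ℕ) : ∀ l, 0 < l → (MvPowerSeries.coeff τ ((Φ : MatOp a) u v)).coeff l = 0 := by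
  classical
  intro l hl
  have h := HasSumCoeff.coeff_eq_zero hΦ.form u v τ l (by omega)
  rw [Matrix.sub_apply, map_sub, PsiDO.coeff_sub, sub_eq_zero] at h
  rw [h, Matrix.one_apply]
  split_ifs
  · rw [MvPowerSeries.coeff_one]
    split_ifs
    · rw [PsiDO.coeff_one, if_neg hl.ne']
    · rfl
  · rfl

theorem IsDressing.mem_matFil {Φ : (MatOp a)ˣ} (hΦ : IsDressing Φ) :
    (Φ : MatOp a) ∈ matFil a 0 := fun u v τ =>
  mem_psiFil_of_nonpos (by omega) (hΦ.coeff_eq_zero u v τ)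

/-- The B type condition gives Φ⁻¹ = ∂⁻¹ Φ^* ∂. The adjoint of an operator of order at most 0 again
has order at most 0, hence weight at least 0, and the weights of ∂⁻¹ and ∂ cancel. -/
theorem IsDressing.inv_mem_matFil {Φ : (MatOp a)ˣ} (hΦ : IsDressing Φ) :
    ((Φ⁻¹ : (MatOp a)ˣ) : MatOp a) ∈ matFil a 0 := by
  have h : adjoint (Φ : MatOp a) ∈ matFil a 0 := fun u v τ => by
    refine mem_psiFil_of_nonpos (by omega) fun l hl => ?_
    refine Eq.trans (finsum_congr fun r => ?_) finsum_zero
    rw [Matrix.transpose_apply, hΦ.coeff_eq_zero v u τ _ (by omega), PsiDO.iter_zero, smul_zero]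
  have h' := mul_mem_matFil (mul_mem_matFil delMat_inv_mem_matFil h) delMat_mem_matFil
  rwa [hΦ.bType, mul_assoc, Units.inv_mul_cancel_right, Units.inv_mul_cancel_left] at h'

theorem IsDressing.conj_mem_matFil {Φ : (MatOp a)ˣ} (hΦ : IsDressing Φ) {n : ℤ} {W : MatOp a}
    (hW : W ∈ matFil a n) : Φ * W * (Φ⁻¹ : (MatOp a)ˣ) ∈ matFil a n := by
  simpa using mul_mem_matFil (mul_mem_matFil hΦ.mem_matFil hW) hΦ.inv_mem_matFil

theorem IsDressing.addB_mem_matFil {Φ : (MatOp a)ˣ} (hΦ : IsDressing Φ) (p r : ℕ) (s : Fin N) :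
    addB Φ p r s ∈ matFil a (p - r) := by
  have hM : orlov Φ ∈ matFil a 1 := hΦ.conj_mem_matFil Gam_mem_matFil
  have hL : (lax Φ : MatOp a) ∈ matFil a (-1) := hΦ.conj_mem_matFil ADel_mem_matFil
  have hL' : (((lax Φ)⁻¹ : (MatOp a)ˣ) : MatOp a) ∈ matFil a 1 := by
    have := hΦ.conj_mem_matFil ADel_inv_mem_matFil
    simpa [lax, mul_assoc] using this
  have hR : projR Φ s ∈ matFil a 0 := hΦ.conj_mem_matFil (E_mem_matFil s)
  have hsign : ((-1) ^ r : MatOp a) ∈ matFil a 0 := by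
    simpa using pow_mem_matFil (neg_mem one_mem_matFil) r
  refine sub_mem ?_ ?_
  · have h := mul_mem_matFil (mul_mem_matFil (pow_mem_matFil hM p) (pow_mem_matFil hL r)) hR
    rwa [show (p : ℤ) * 1 + r * (-1) + 0 = p - r by ring] at h
  · have h := mul_mem_matFil (mul_mem_matFil (mul_mem_matFil (mul_mem_matFil hsign hR)
      (zpow_mem_matFil hL hL' ((r : ℤ) - 1))) (pow_mem_matFil hM p)) hL
    -- In the second term L^(r-1) and the final L together contribute weight -r, so both terms of B
    -- have the same bound p - r.
    rwa [show 0 + 0 + ((r : ℤ) - 1) * (-1) + (p : ℤ) * 1 + -1 = p - r by ring] at h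

theorem IsDressing.entryCoeff_negPart_addB_eq_zero {Φ : (MatOp a)ˣ} (hΦ : IsDressing Φ)
    {p r : ℕ} (s u v : Fin N) (τ : Fin N × ℕ →₀ ℕ) (l : ℤ) (β : Fin N →₀ ℕ)
    (h : (r : ℤ) + timeWeight N τ - l + β.degree < p) :
    entryCoeff (negPart (addB Φ p r s)) u v τ l β = 0 := by
  rw [entryCoeff, coeff_negPart, PsiDO.coeff_negPart]
  split_ifs
  · exact hΦ.addB_mem_matFil p r s u v τ l β (by omega)
  · exact map_zero _

end Filtration

/-- For a formal parameter `log q` the series defining an additional flow converges. -/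
theorem IsDressing.exists_isNegPartD {N : ℕ} {a : Fin N → (PowerSeries ℂ)ˣ} {Φ : (MatOp a)ˣ}
    (hΦ : IsDressing Φ) (l k : ℕ) (s : Fin N) :
    ∃ X : MatOp a, IsNegPartD (PowerSeries.X : PowerSeries ℂ) Φ l k s X := by
  let f (u v : Fin N) (τ : Fin N × ℕ →₀ ℕ) (m : ℤ) (β : Fin N →₀ ℕ) (x : ℕ × ℕ) :
      PowerSeries ℂ :=
    ((l : PowerSeries ℂ) ^ x.1 * ((k : PowerSeries ℂ) * PowerSeries.X) ^ x.2
        * algebraMap ℚ (PowerSeries ℂ) (1 / (Nat.factorial x.1 * Nat.factorial x.2)))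
      * entryCoeff (negPart (addB Φ x.1 x.2 s)) u v τ m β
  have hf0 (u v τ m β) (hm : -1 < m) (x) : f u v τ m β x = 0 := by
    have : entryCoeff (negPart (addB Φ x.1 x.2 s)) u v τ m β = 0 := by
      rw [entryCoeff, coeff_negPart, PsiDO.coeff_negPart, if_neg (by omega), map_zero]
    simp only [f, this, mul_zero]
  have hf (u v τ m β) : Summable (f u v τ m β) := by
    rw [PowerSeries.WithPiTopology.summable_iff_summable_coeff]
    intro d
    -- For the coefficient of ħ^d, divisibility by ħ^r forces r ≤ d, and the weight bound then
    -- confines p to at most d plus the weight of the chosen monomial.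
    refine summable_of_hasFiniteSupport ((Set.finite_Iic
      (d + ((timeWeight N τ : ℤ) - m + β.degree).toNat, d)).subset fun x hx => ?_)
    rw [Function.mem_support] at hx
    have hr : x.2 ≤ d := by
      by_contra hr
      refine hx (PowerSeries.X_pow_dvd_iff.1 ?_ d (not_le.1 hr))
      exact (((pow_dvd_pow_of_dvd (Dvd.intro_left _ rfl) _).mul_left _).mul_right _).mul_right _
    have hp : (x.1 : ℤ) ≤ x.2 + timeWeight N τ - m + β.degree := by
      by_contra hp
      refine hx ?_
      simp only [f, hΦ.entryCoeff_negPart_addB_eq_zero s u v τ m β (not_le.1 hp), mul_zero,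
        map_zero]
    rw [Set.mem_Iic, Prod.le_def]
    refine ⟨?_, hr⟩
    simp only
    omega
  -- The entrywise sums form a genuine operator: all terms are negative, so -1 bounds the order.
  refine ⟨fun u v τ => ⟨fun m β => ∑' x, f u v τ m β x, -1, fun m hm => ?_⟩,
    fun u v τ m β => (hf u v τ m β).hasSum⟩
  funext β
  simp only [hf0 _ _ _ _ _ hm, tsum_zero]
  rfl

end BKP

end

theorem mainTheorem5 (N : ℕ) :
    -- commutation, over any ring of constants, whenever the series defining the flow converges
    (∀ (𝕜 : Type*) [CommRing 𝕜] [Algebra ℚ 𝕜] [TopologicalSpace 𝕜] [IsTopologicalRing 𝕜]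
        [T2Space 𝕜] (a : Fin N → 𝕜ˣ) (logq : 𝕜) (Φ : (BKP.MatOp a)ˣ), BKP.IsDressing Φ →
      ∀ (l k : ℕ) (s : Fin N) (X : BKP.MatOp a), BKP.IsNegPartD logq Φ l k s X →
      ∀ (j : Fin N) (i : ℕ), BKP.flowCommutator Φ (-X * Φ) j i = 0) ∧
    -- for a formal parameter `log q` the series always converges
    (∀ (a : Fin N → (PowerSeries ℂ)ˣ) (Φ : (BKP.MatOp a)ˣ), BKP.IsDressing Φ →
      ∀ (l k : ℕ) (s : Fin N), ∃ X : BKP.MatOp a,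
        BKP.IsNegPartD (PowerSeries.X : PowerSeries ℂ) Φ l k s X) :=
  ⟨fun _ _ _ _ _ _ _ _ _ hΦ _ _ _ _ hX j i => hX.flowCommutator_eq_zero hΦ j i,
    fun _ _ hΦ l k s => hΦ.exists_isNegPartD l k s⟩
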